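/- Let $(M,\sigma,g)$ be a paraquaternionic Kähler manifold, that is: $M$ is a smooth manifold; $\sigma$ is a rank-3 subbundle of $\mathrm{End}(TM)$ which near each point has a canonical local basis $\{J_1,J_2,J_3\}$, meaning a smooth local basis with $$J_\alpha^2=-\epsilon_\alpha\,\mathrm{Id},\qquad J_\alpha J_{\alpha+1}=-J_{\alpha+1}J_\alpha=\epsilon_{\alpha+2}J_{\alpha+2}\qquad(\alpha\in\{1,2,3\}\bmod 3),\quad \epsilon_1=1,\ \epsilon_2=\epsilon_3=-1;$$ $g$ is a semi-Riemannian metric with $g(J_\alpha X,J_\alpha Y)=\epsilon_\alpha g(X,Y)$ for all vectors $X,Y$ and every canonical local basis of $\sigma$; and $\sigma$ is parallel with respect to the Levi-Civita connection of $g$. Let $N$ be an $n$-dimensional paraquaternionic CR-submanifold of $M$, that is: $N$ is an immersed submanifold on which $g$ restricts to a non-degenerate metric, together with a smooth distribution $\mathcal D\subseteq TN$, of some constant rank $r$, on which $g$ is non-degenerate, such that for every canonical local basis $\{J_1,J_2,J_3\}$ of $\sigma$ on an open set $U$, every $x\in U\cap N$ and every $\alpha$, $$J_\alpha\mathcal D_x=\mathcal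 D_x,\qquad J_\alpha\mathcal D^\perp_x\subseteq T_xN^\perp,$$ where $\mathcal D^\perp$ is the orthogonal complement of $\mathcal D$ in $TN$ and $T_xN^\perp$ is the normal space of $N$ at $x$. Then the totally real distribution $\mathcal D^\perp$ is integrable: the Lie bracket of any two smooth local sections of $\mathcal D^\perp$ is again a section of $\mathcal D^\perp$, and each point of $N$ has a smooth coordinate chart whose slices parallel to $\mathbb R^{n-r}\times\{0\}$ are integral manifolds of $\mathcal D^\perp$. Consequently there is exactly one foliation of $N$ (maximal smooth foliated atlas with leaves of dimension $n-r$) whose tangent distribution is $\mathcal D^\perp$; it is called the canonical totally real foliation $\mathfrak F^\perp$ of $N$. -/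

import Mathlib

open Set Manifold Bundle
open scoped Manifold ContDiff Topology

noncomputable section

namespace ParaquaternionicCR

section Ambient

variable (d : ℕ) (M : Type*) [TopologicalSpace M] [ChartedSpace (EuclideanSpace ℝ (Fin d)) M]
  [IsManifold (𝓡 d) ∞ M]

/-- A semi-Riemannian metric: a smooth field of symmetric non-degenerate bilinear forms on the
tangent spaces (of arbitrary signature). -/
structure SemiRiemannianMetric where
  /-- the scalar product on each tangent space -/
  toFun : ∀ x : M, TangentSpace (𝓡 d) x →L[ℝ] TangentSpace (𝓡 d) x →L[ℝ] ℝ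
  symm : ∀ (x : M) (v w : TangentSpace (𝓡 d) x), toFun x v w = toFun x w v
  nondegenerate : ∀ (x : M) (v : TangentSpace (𝓡 d) x), (∀ w, toFun x v w = 0) → v = 0
  contMDiff : ContMDiff (𝓡 d)
    ((𝓡 d).prod 𝓘(ℝ, EuclideanSpace ℝ (Fin d) →L[ℝ] EuclideanSpace ℝ (Fin d) →L[ℝ] ℝ)) ∞
    (fun x : M ↦ TotalSpace.mk'
      (EuclideanSpace ℝ (Fin d) →L[ℝ] EuclideanSpace ℝ (Fin d) →L[ℝ] ℝ)
      (E := fun x : M ↦ TangentSpace (𝓡 d) x →L[ℝ] TangentSpace (𝓡 d) x →L[ℝ] ℝ) x (toFun x))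

/-- A (not necessarily continuous) field of endomorphisms of the tangent spaces. -/
abbrev EndField := ∀ x : M, TangentSpace (𝓡 d) x →L[ℝ] TangentSpace (𝓡 d) x

variable {d M}

/-- Smoothness on `U` of a field of endomorphisms, as a section of the bundle `End(TM)`. -/
def SmoothEndOn (S : EndField d M) (U : Set M) : Prop :=
  ContMDiffOn (𝓡 d)
    ((𝓡 d).prod 𝓘(ℝ, EuclideanSpace ℝ (Fin d) →L[ℝ] EuclideanSpace ℝ (Fin d))) ∞
    (fun x : M ↦ TotalSpace.mk' (EuclideanSpace ℝ (Fin d) →L[ℝ] EuclideanSpace ℝ (Fin d))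
      (E := fun x : M ↦ TangentSpace (𝓡 d) x →L[ℝ] TangentSpace (𝓡 d) x) x (S x)) U

/-- The signs `ε₁ = 1`, `ε₂ = ε₃ = -1`; the indices `1, 2, 3` are written `0, 1, 2 : Fin 3`, so
that addition of indices is modulo 3. -/
def eps : Fin 3 → ℝ := ![1, -1, -1]

/-- `J₁, J₂, J₃` is a canonical local basis, on the open set `U`, of the field `σ` of spaces of
endomorphisms. -/
structure IsCanonicalLocalBasis
    (σ : ∀ x : M, Submodule ℝ (TangentSpace (𝓡 d) x →L[ℝ] TangentSpace (𝓡 d) x))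
    (U : Set M) (J : Fin 3 → EndField d M) : Prop where
  isOpen : IsOpen U
  smooth : ∀ α, SmoothEndOn (J α) U
  linearIndependent : ∀ x ∈ U, LinearIndependent ℝ (fun α ↦ J α x)
  span_eq : ∀ x ∈ U, Submodule.span ℝ (range fun α ↦ J α x) = σ x
  sq : ∀ x ∈ U, ∀ α, J α x ∘L J α x = -(eps α) • ContinuousLinearMap.id ℝ _
  mul : ∀ x ∈ U, ∀ α, J α x ∘L J (α + 1) x = eps (α + 2) • J (α + 2) x
  anticomm : ∀ x ∈ U, ∀ α, J α x ∘L J (α + 1) x = -(J (α + 1) x ∘L J α x)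

variable (d M) in
/-- An almost paraquaternionic structure: a rank-3 subbundle of `End(TM)` that has a canonical
local basis near each point. -/
structure AlmostParaquaternionicStructure where
  /-- the fibre of the subbundle at each point -/
  toFun : ∀ x : M, Submodule ℝ (TangentSpace (𝓡 d) x →L[ℝ] TangentSpace (𝓡 d) x)
  exists_basis : ∀ x : M, ∃ (U : Set M) (J : Fin 3 → EndField d M),
    x ∈ U ∧ IsCanonicalLocalBasis toFun U J

/-- The metric is adapted to the almost paraquaternionic structure, i.e. `(M, σ, g)` is an almost
paraquaternionic hermitian manifold. -/
def IsAdapted (σ : AlmostParaquaternionicStructure d M) (g : SemiRiemannianMetric d M) : Prop :=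
  ∀ (U : Set M) (J : Fin 3 → EndField d M), IsCanonicalLocalBasis σ.toFun U J →
    ∀ x ∈ U, ∀ (α : Fin 3) (v w : TangentSpace (𝓡 d) x),
      g.toFun x (J α x v) (J α x w) = eps α * g.toFun x v w

/-- The vector field `Y` is differentiable at `x`. -/
def VFDiffAt (Y : ∀ x : M, TangentSpace (𝓡 d) x) (x : M) : Prop :=
  MDifferentiableAt (𝓡 d) (𝓡 d).tangent (fun y : M ↦ (⟨y, Y y⟩ : TangentBundle (𝓡 d) M)) x

/-- `cov` is the Levi-Civita connection of `g`: it is torsion-free and metric. In Mathlib's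
convention, `cov Y x v` is `∇_v Y` at `x`. -/
structure IsLeviCivita (g : SemiRiemannianMetric d M)
    (cov : CovariantDerivative (𝓡 d) (EuclideanSpace ℝ (Fin d))
      (TangentSpace (𝓡 d) : M → Type _)) : Prop where
  torsion_eq_zero : cov.torsion = 0
  metric : ∀ (x : M) (v : TangentSpace (𝓡 d) x) (Y Z : ∀ x : M, TangentSpace (𝓡 d) x),
    VFDiffAt Y x → VFDiffAt Z x →
      mvfderiv (𝓡 d) (fun y ↦ g.toFun y (Y y) (Z y)) x v =
        g.toFun x (cov Y x v) (Z x) + g.toFun x (Y x) (cov Z x v)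

/-- The subbundle `σ` of `End(TM)` is parallel: for each smooth local section `S` of `σ` and each
tangent vector `v` at a point `x` of its domain, the covariant derivative `B = (∇_v S)_x`,
which is given by `(∇_v S) Y = ∇_v (S Y) - S (∇_v Y)`, lies in `σ_x`. -/
def IsParallel (σ : AlmostParaquaternionicStructure d M)
    (cov : CovariantDerivative (𝓡 d) (EuclideanSpace ℝ (Fin d))
      (TangentSpace (𝓡 d) : M → Type _)) : Prop :=
  ∀ (U : Set M) (S : EndField d M), IsOpen U → SmoothEndOn S U → (∀ y ∈ U, S y ∈ σ.toFun y) →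
    ∀ x ∈ U, ∀ v : TangentSpace (𝓡 d) x, ∃ B ∈ σ.toFun x,
      ∀ Y : (∀ x : M, TangentSpace (𝓡 d) x), VFDiffAt Y x →
        B (Y x) = cov (fun y ↦ S y (Y y)) x v - S x (cov Y x v)

/-- `(M, σ, g)` is a paraquaternionic Kähler manifold. -/
structure IsParaquaternionicKahler (σ : AlmostParaquaternionicStructure d M)
    (g : SemiRiemannianMetric d M) : Prop where
  adapted : IsAdapted σ g
  parallel : ∃ cov : CovariantDerivative (𝓡 d) (EuclideanSpace ℝ (Fin d))
    (TangentSpace (𝓡 d) : M → Type _), IsLeviCivita g cov ∧ IsParallel σ cov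

end Ambient

section Distributions

variable {n : ℕ} {N : Type*} [TopologicalSpace N] [ChartedSpace (EuclideanSpace ℝ (Fin n)) N]
  [IsManifold (𝓡 n) ∞ N]

/-- Smoothness of a vector field on a set. -/
def VFSmoothOn (X : ∀ x : N, TangentSpace (𝓡 n) x) (U : Set N) : Prop :=
  ContMDiffOn (𝓡 n) (𝓡 n).tangent ∞ (fun x : N ↦ (⟨x, X x⟩ : TangentBundle (𝓡 n) N)) U

/-- `D` is a smooth distribution of rank `r`, i.e. a rank-`r` subbundle of `TN`: near each point
it has a smooth frame of `r` vector fields. -/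
def IsDistribution (r : ℕ) (D : ∀ x : N, Submodule ℝ (TangentSpace (𝓡 n) x)) : Prop :=
  ∀ x₀ : N, ∃ (U : Set N) (X : Fin r → ∀ x : N, TangentSpace (𝓡 n) x), IsOpen U ∧ x₀ ∈ U ∧
    (∀ i, VFSmoothOn (X i) U) ∧
    ∀ x ∈ U, LinearIndependent ℝ (fun i ↦ X i x) ∧ Submodule.span ℝ (range fun i ↦ X i x) = D x

/-- `D` is involutive: the Lie bracket of two smooth local sections of `D` is a section of `D`. -/
def IsInvolutive (D : ∀ x : N, Submodule ℝ (TangentSpace (𝓡 n) x)) : Prop :=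
  ∀ (W : Set N) (X Y : ∀ x : N, TangentSpace (𝓡 n) x), IsOpen W →
    VFSmoothOn X W → VFSmoothOn Y W → (∀ x ∈ W, X x ∈ D x) → (∀ x ∈ W, Y x ∈ D x) →
      ∀ x ∈ W, VectorField.mlieBracket (𝓡 n) X Y x ∈ D x

/-- The subspace `ℝᵖ × {0}` of `ℝⁿ`. Its translates are the model leaves. -/
def modelLeaf (n p : ℕ) : Submodule ℝ (EuclideanSpace ℝ (Fin n)) where
  carrier := {v | ∀ i : Fin n, p ≤ i.val → v i = 0}
  zero_mem' := by
    intro i _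
    simp
  add_mem' := by
    intro a b ha hb i hi
    simp [ha i hi, hb i hi]
  smul_mem' := by
    intro c a ha i hi
    simp [ha i hi]

/-- The chart `φ` is flat for `D`: it carries `D` to the constant distribution `ℝᵖ × {0}`, so that
the slices of `φ` parallel to `ℝᵖ × {0}` are integral manifolds of `D`. -/
def IsFlatOn (p : ℕ) (D : ∀ x : N, Submodule ℝ (TangentSpace (𝓡 n) x))
    (φ : OpenPartialHomeomorph N (EuclideanSpace ℝ (Fin n))) : Prop :=
  ∀ x ∈ φ.source, ∀ v : TangentSpace (𝓡 n) x,
    v ∈ D x ↔ mvfderiv (𝓡 n) φ x v ∈ modelLeaf n p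

/-- The rank-`p` distribution `D` is (completely) integrable: near each point of `N` there are
smooth coordinates whose slices parallel to `ℝᵖ × {0}` are integral manifolds of `D`. -/
def IsIntegrable (p : ℕ) (D : ∀ x : N, Submodule ℝ (TangentSpace (𝓡 n) x)) : Prop :=
  ∀ x : N, ∃ φ ∈ IsManifold.maximalAtlas (𝓡 n) ∞ N, x ∈ φ.source ∧ IsFlatOn p D φ

/-- The transition map `ψ ∘ φ⁻¹` maps, locally, points with the same last `n - p` coordinates
to points with the same last `n - p` coordinates; i.e. it is locally of the form
`(x, y) ↦ (h₁(x, y), h₂(y))`. -/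
def PlaqueCompatible (p : ℕ) (φ ψ : OpenPartialHomeomorph N (EuclideanSpace ℝ (Fin n))) : Prop :=
  ∀ z ∈ (φ.symm.trans ψ).source, ∃ W : Set (EuclideanSpace ℝ (Fin n)), IsOpen W ∧ z ∈ W ∧
    W ⊆ (φ.symm.trans ψ).source ∧
    ∀ a ∈ W, ∀ b ∈ W, a - b ∈ modelLeaf n p → ψ (φ.symm a) - ψ (φ.symm b) ∈ modelLeaf n p

variable (n N) in
/-- A smooth foliation of `N` by `p`-dimensional leaves: a maximal foliated atlas. -/
@[ext]
structure Foliation (p : ℕ) where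
  /-- the foliated charts -/
  atlas : Set (OpenPartialHomeomorph N (EuclideanSpace ℝ (Fin n)))
  subset_maximalAtlas : atlas ⊆ IsManifold.maximalAtlas (𝓡 n) ∞ N
  covers : ∀ x : N, ∃ φ ∈ atlas, x ∈ φ.source
  compatible : ∀ φ ∈ atlas, ∀ ψ ∈ atlas, PlaqueCompatible p φ ψ
  maximal : ∀ φ ∈ IsManifold.maximalAtlas (𝓡 n) ∞ N,
    (∀ ψ ∈ atlas, PlaqueCompatible p φ ψ ∧ PlaqueCompatible p ψ φ) → φ ∈ atlas

/-- `D` is the structural distribution of the foliation: the tangent distribution to its leaves. -/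
def Foliation.HasStructuralDistribution {p : ℕ} (F : Foliation n N p)
    (D : ∀ x : N, Submodule ℝ (TangentSpace (𝓡 n) x)) : Prop :=
  ∀ φ ∈ F.atlas, IsFlatOn p D φ

end Distributions

section Submanifold

variable {d : ℕ} {M : Type*} [TopologicalSpace M] [ChartedSpace (EuclideanSpace ℝ (Fin d)) M]
  [IsManifold (𝓡 d) ∞ M]
  {n : ℕ} {N : Type*} [TopologicalSpace N] [ChartedSpace (EuclideanSpace ℝ (Fin n)) N]
  [IsManifold (𝓡 n) ∞ N]

/-- The metric induced on `N` by the map `ι : N → M`. -/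
def inducedMetric (g : SemiRiemannianMetric d M) (ι : N → M) (x : N)
    (v w : TangentSpace (𝓡 n) x) : ℝ :=
  g.toFun (ι x) (mfderiv (𝓡 n) (𝓡 d) ι x v) (mfderiv (𝓡 n) (𝓡 d) ι x w)

/-- The induced metric is non-degenerate on each of the given subspaces of the tangent spaces. -/
def IsNondegenerateOn (g : SemiRiemannianMetric d M) (ι : N → M)
    (D : ∀ x : N, Submodule ℝ (TangentSpace (𝓡 n) x)) : Prop :=
  ∀ x : N, ∀ v ∈ D x, (∀ w ∈ D x, inducedMetric g ι x v w = 0) → v = 0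

/-- The orthogonal complementary distribution `D^⊥` of `D` in `TN`. -/
def orthDistribution (g : SemiRiemannianMetric d M) (ι : N → M)
    (D : ∀ x : N, Submodule ℝ (TangentSpace (𝓡 n) x)) (x : N) :
    Submodule ℝ (TangentSpace (𝓡 n) x) where
  carrier := {v | ∀ w ∈ D x, inducedMetric g ι x v w = 0}
  zero_mem' := by
    intro w _
    simp [inducedMetric]
  add_mem' := by
    intro a b ha hb w hw
    have h1 := ha w hw
    have h2 := hb w hw
    simp only [inducedMetric] at h1 h2 ⊢
    simp [h1, h2]
  smul_mem' := by
    intro c a ha w hw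
    have h1 := ha w hw
    simp only [inducedMetric] at h1 ⊢
    simp [h1]

/-- The vector `u` is normal to `N` at `x`, i.e. it lies in `T_x N^⊥`. -/
def IsNormalAt (n : ℕ) {N : Type*} [TopologicalSpace N]
    [ChartedSpace (EuclideanSpace ℝ (Fin n)) N]
    (g : SemiRiemannianMetric d M) (ι : N → M) (x : N)
    (u : TangentSpace (𝓡 d) (ι x)) : Prop :=
  ∀ v : TangentSpace (𝓡 n) x, g.toFun (ι x) u (mfderiv (𝓡 n) (𝓡 d) ι x v) = 0

/-- `N`, immersed in `(M, σ, g)` by `ι`, is a paraquaternionic CR-submanifold, with `D` (of rank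
`r`) as its paraquaternionic distribution. -/
structure IsParaquaternionicCRSubmanifold (σ : AlmostParaquaternionicStructure d M)
    (g : SemiRiemannianMetric d M) (ι : N → M) (r : ℕ)
    (D : ∀ x : N, Submodule ℝ (TangentSpace (𝓡 n) x)) : Prop where
  isImmersion : IsImmersion (𝓡 n) (𝓡 d) ∞ ι
  nondegenerate : IsNondegenerateOn g ι
    (fun x : N ↦ (⊤ : Submodule ℝ (TangentSpace (𝓡 n) x)))
  isDistribution : IsDistribution r D
  nondegenerate_distribution : IsNondegenerateOn g ι D
  paraquaternionic : ∀ (U : Set M) (J : Fin 3 → EndField d M),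
    IsCanonicalLocalBasis σ.toFun U J → ∀ x : N, ι x ∈ U → ∀ α : Fin 3,
      J α (ι x) '' (mfderiv (𝓡 n) (𝓡 d) ι x '' (D x)) = mfderiv (𝓡 n) (𝓡 d) ι x '' (D x)
  totallyReal : ∀ (U : Set M) (J : Fin 3 → EndField d M),
    IsCanonicalLocalBasis σ.toFun U J → ∀ x : N, ι x ∈ U → ∀ α : Fin 3,
      ∀ v ∈ orthDistribution g ι D x,
        IsNormalAt n g ι x (J α (ι x) (mfderiv (𝓡 n) (𝓡 d) ι x v))

end Submanifold

end ParaquaternionicCR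

end

noncomputable section

set_option maxSynthPendingDepth 3
set_option linter.unusedSectionVars false

/-! Let `J` be a member of a canonical local basis and `Ω = g (J ·, ·)`. Adaptedness together with
`J² = -ε` makes every element of `σ` skew for `g`, so `Ω` is a two-form. The kernel of its pullback
to `N` is exactly `D^⊥`: total reality gives one inclusion, and `J D = D` with skewness the other
(`mem_orthDistribution_iff`). Non-degeneracy of the induced metric gives this kernel the constant
rank `n - r`.

For the torsion-free metric connection, `dΩ (a, b, e)` is the cyclic sum of `g ((∇_a J) b, e)`, and
parallelism places each `∇_a J` in `σ`. If `a` and `b` lie in `D^⊥`, every term is, up to sign, the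
pairing of a tangent vector of `N` with an element of `σ` applied to `a` or `b`. Such images are
normal, so `dΩ` vanishes on pairs of kernel vectors (`extDerivBilin_inducedForm`). Differentiating
`Ω (X, ·) = 0 = Ω (Y, ·)` then shows that the kernel is closed under brackets
(`apply_lieBracket_eq_zero`).

Frobenius is proved for kernels of such forms (`exists_flat_coordinates_ker`). Locally the kernel is
the graph of `A : H × K → H →L[ℝ] K`, and closure under brackets becomes the symmetry condition for
the equation `∂Φ/∂x = A (x, Φ)`, `Φ (0, y) = y`. A solution is the value at time `1` of the radial
ODE `γ' = A (t x, γ) x`, `γ 0 = y`. Smooth dependence on `(x, y)` comes from the inverse function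
theorem on `C(unitInterval, K)`, and the symmetry condition identifies the `x`-derivative of the
solution. The inverse of `(x, y) ↦ (x, Φ (x, y))` flattens the graphs.

Finally, the flat charts form a maximal foliated atlas. Flatness for the same distribution gives
plaque compatibility by the mean value theorem, and compatibility with flat charts forces flatness
by differentiation along plaques. This yields existence and uniqueness of the foliation. -/

namespace ParaquaternionicCR

/-! ### Smoothness of left composition on spaces of continuous functions -/

section Postcomposition

universe u

variable {X : Type*} [TopologicalSpace X] [CompactSpace X]
  {E F G : Type u} [NormedAddCommGroup E] [NormedSpace ℝ E] [NormedAddCommGroup F]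
  [NormedSpace ℝ F] [NormedAddCommGroup G] [NormedSpace ℝ G]

/-- The pointwise extension of a continuous bilinear map to spaces of continuous functions. -/
def pointwiseBilin (X : Type*) [TopologicalSpace X] [CompactSpace X] (B : G →L[ℝ] E →L[ℝ] F) :
    C(X, G) →L[ℝ] C(X, E) →L[ℝ] C(X, F) :=
  LinearMap.mkContinuous₂
    (LinearMap.mk₂ ℝ (fun (A : C(X, G)) (γ : C(X, E)) ↦
        (⟨fun t ↦ B (A t) (γ t), by fun_prop⟩ : C(X, F)))
      (fun _ _ _ ↦ by ext; simp) (fun _ _ _ ↦ by ext; simp)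
      (fun _ _ _ ↦ by ext; simp) (fun _ _ _ ↦ by ext; simp)) ‖B‖
    (fun A γ ↦ by
      refine (ContinuousMap.norm_le _ (by positivity)).2 fun t ↦ ?_
      exact (B.le_opNorm₂ _ _).trans (by gcongr <;> exact ContinuousMap.norm_coe_le_norm _ _))

/-- Composition on the left with a `C¹` function is differentiable on spaces of continuous
functions with compact domain. -/
lemma hasFDerivAt_postcomp_of_bilin (B : G →L[ℝ] E →L[ℝ] F) (f : C(E, F)) (f' : C(E, G))
    (hf : ∀ x, HasFDerivAt f (B (f' x)) x) (γ : C(X, E)) :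
    HasFDerivAt (fun γ : C(X, E) ↦ f.comp γ) (pointwiseBilin X B (f'.comp γ)) γ := by
  rw [hasFDerivAt_iff_isLittleO_nhds_zero, Asymptotics.isLittleO_iff]
  intro ε hε
  have hcont : Continuous fun η : C(X, E) ↦ f'.comp η := ContinuousMap.continuous_postcomp f'
  -- The `+ 1` keeps the quotient meaningful when `B = 0`.
  have hε' : 0 < ε / (‖B‖ + 1) := by positivity
  obtain ⟨δ, hδ, H⟩ := Metric.continuous_iff.1 hcont γ _ hε'
  filter_upwards [Metric.ball_mem_nhds (0 : C(X, E)) hδ] with h hh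
  refine (ContinuousMap.norm_le _ (by positivity)).2 fun t ↦ ?_
  have key : ∀ y ∈ Metric.ball (γ t) δ, ‖B (f' y) - B (f' (γ t))‖ ≤ ε := by
    intro y hy
    -- Translating `γ` by the constant `y - γ t` gives a function through `y` at `t` and within `δ`
    -- of `γ`. Continuity of `η ↦ f' ∘ η` at `γ` thus yields a bound near `γ t` that is uniform in
    -- `t`.
    have h1 : dist (γ + ContinuousMap.const X (y - γ t)) γ < δ := by
      rw [dist_eq_norm, add_sub_cancel_left]
      refine lt_of_le_of_lt ((ContinuousMap.norm_le _ (norm_nonneg _)).2 fun s ↦ le_rfl) ?_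
      rwa [Metric.mem_ball, dist_eq_norm] at hy
    have h2 := (ContinuousMap.dist_le hε'.le).1 (H _ h1).le t
    simp only [dist_eq_norm, ContinuousMap.comp_apply, ContinuousMap.add_apply,
      ContinuousMap.const_apply, add_sub_cancel] at h2
    rw [← map_sub]
    calc _ ≤ ‖B‖ * ‖f' y - f' (γ t)‖ := B.le_opNorm _
      _ ≤ (‖B‖ + 1) * (ε / (‖B‖ + 1)) := by gcongr; linarith
      _ = ε := by field_simp
  have hh' : ‖h‖ < δ := by simpa using hh
  have ht : ‖h t‖ ≤ ‖h‖ := ContinuousMap.norm_coe_le_norm h t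
  have := (convex_ball (γ t) δ).norm_image_sub_le_of_norm_hasFDerivWithin_le'
    (f := f) (f' := fun y ↦ B (f' y)) (φ := B (f' (γ t))) (C := ε) (x := γ t) (y := γ t + h t)
    (fun y _ ↦ (hf y).hasFDerivWithinAt) key (by simpa using hδ) (by simpa using ht.trans_lt hh')
  rw [add_sub_cancel_left] at this
  exact this.trans (by gcongr)

/-- The derivative is a bounded linear map applied to `γ ↦ f' ∘ γ`, so one order of smoothness is
gained from the same statement for `f'`. -/
lemma contDiff_succ_postcomp (B : G →L[ℝ] E →L[ℝ] F) (f : C(E, F)) (f' : C(E, G))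
    (hf : ∀ x, HasFDerivAt f (B (f' x)) x) (n : ℕ)
    (h : ContDiff ℝ n (fun γ : C(X, E) ↦ f'.comp γ)) :
    ContDiff ℝ (n + 1) (fun γ : C(X, E) ↦ f.comp γ) :=
  contDiff_succ_iff_hasFDerivAt.2
    ⟨_, (pointwiseBilin X B).contDiff.comp h, hasFDerivAt_postcomp_of_bilin B f f' hf⟩

/-- The target varies in the induction because the derivative takes values in `E →L[ℝ] F`; this is
why all the spaces share one universe. -/
lemma contDiff_nat_postcomp (n : ℕ) : ∀ {F : Type u} [NormedAddCommGroup F] [NormedSpace ℝ F]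
    (f : C(E, F)), ContDiff ℝ ∞ f → ContDiff ℝ n (fun γ : C(X, E) ↦ f.comp γ) := by
  induction n with
  | zero =>
    intro F _ _ f hf
    exact contDiff_zero.2 (ContinuousMap.continuous_postcomp _)
  | succ n ih =>
    intro F _ _ f hf
    have hDf : ContDiff ℝ ∞ (fderiv ℝ f) := hf.fderiv_right (by simp)
    push_cast
    exact contDiff_succ_postcomp (G := E →L[ℝ] F) (ContinuousLinearMap.id ℝ _) f
      ⟨fderiv ℝ f, hDf.continuous⟩ (fun x ↦ ((hf.differentiable (by simp)) x).hasFDerivAt) n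
      (ih (F := E →L[ℝ] F) ⟨fderiv ℝ f, hDf.continuous⟩ hDf)

/-- Composition on the left with a smooth function is smooth on spaces of continuous
functions with compact domain. -/
theorem contDiff_postcomp (f : C(E, F)) (hf : ContDiff ℝ ∞ f) :
    ContDiff ℝ ∞ (fun γ : C(X, E) ↦ f.comp γ) :=
  contDiff_infty.2 fun n ↦ contDiff_nat_postcomp n f hf

lemma fderiv_postcomp_apply (f : C(E, F)) (hf : ContDiff ℝ ∞ f) (γ h : C(X, E)) (t : X) :
    fderiv ℝ (fun γ : C(X, E) ↦ f.comp γ) γ h t = fderiv ℝ f (γ t) (h t) := by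
  have hDf : ContDiff ℝ ∞ (fderiv ℝ f) := hf.fderiv_right (by simp)
  rw [(hasFDerivAt_postcomp_of_bilin (G := E →L[ℝ] F) (ContinuousLinearMap.id ℝ _) f
        ⟨fderiv ℝ f, hDf.continuous⟩
        (fun x ↦ ((hf.differentiable (by simp)) x).hasFDerivAt) γ).fderiv]
  rfl

end Postcomposition

/-! ### Smooth local inverses -/

section LocalInverse

variable {E F : Type*} [NormedAddCommGroup E] [NormedSpace ℝ E] [CompleteSpace E]
  [NormedAddCommGroup F] [NormedSpace ℝ F]

/-- The inverse function theorem for smooth functions, on a neighbourhood on which the inverse is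
smooth and the derivative is invertible. -/
lemma exists_openPartialHomeomorph_of_hasFDerivAt_equiv {f : E → F} {U : Set E} (hU : IsOpen U)
    (hf : ContDiffOn ℝ ∞ f U) {a : E} (ha : a ∈ U) {f' : E ≃L[ℝ] F}
    (hf' : HasFDerivAt f (f' : E →L[ℝ] F) a) :
    ∃ e : OpenPartialHomeomorph E F, a ∈ e.source ∧ e.source ⊆ U ∧ (e : E → F) = f ∧
      ContDiffOn ℝ ∞ e.symm e.target ∧
      ∀ x ∈ e.source, ∃ D : E ≃L[ℝ] F, HasFDerivAt f (D : E →L[ℝ] F) x := by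
  have hfa : ContDiffAt ℝ ∞ f a := (hf a ha).contDiffAt (hU.mem_nhds ha)
  set e₀ := hfa.toOpenPartialHomeomorph f hf' (by simp) with he₀
  -- Invertible maps form an open set, so the source can be shrunk to the points with invertible
  -- derivative. The inverse is then smooth on the whole target and not only at the image of `a`.
  set V : Set E := U ∩ fderiv ℝ f ⁻¹' range ((↑) : (E ≃L[ℝ] F) → E →L[ℝ] F) with hV
  have hVo : IsOpen V :=
    (hf.continuousOn_fderiv_of_isOpen hU (by simp)).isOpen_inter_preimage hU
      ContinuousLinearEquiv.isOpen
  have hder : ∀ x ∈ V, ∃ D : E ≃L[ℝ] F, HasFDerivAt f (D : E →L[ℝ] F) x := by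
    rintro x ⟨hx, D, hD⟩
    refine ⟨D, hD ▸ DifferentiableAt.hasFDerivAt ?_⟩
    exact ((hf x hx).contDiffAt (hU.mem_nhds hx)).differentiableAt (by simp)
  have hcoe : (e₀ : E → F) = f := rfl
  refine ⟨e₀.restrOpen V hVo, ⟨?_, ha, f', hf'.fderiv.symm⟩, fun x hx ↦ hx.2.1, rfl, ?_,
    fun x hx ↦ hder x hx.2⟩
  · exact hfa.mem_toOpenPartialHomeomorph_source hf' (by simp)
  · intro y hy
    have hy' := (e₀.restrOpen V hVo).map_target hy
    obtain ⟨D, hD⟩ := hder _ hy'.2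
    exact ((e₀.restrOpen V hVo).contDiffAt_symm hy hD
      ((hf _ hy'.2.1).contDiffAt (hU.mem_nhds hy'.2.1))).contDiffWithinAt

end LocalInverse

/-! ### Integration as a bounded operator on paths -/

section Primitive

variable {K : Type*} [NormedAddCommGroup K] [NormedSpace ℝ K]

/-- The primitive vanishing at `0` of a continuous function on the unit interval. -/
def primitiveL : C(unitInterval, K) →L[ℝ] C(unitInterval, K) :=
  LinearMap.mkContinuous
    { toFun := fun f ↦ ⟨fun t ↦ ∫ s in (0 : ℝ)..t, f (projIcc 0 1 zero_le_one s), by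
        have : Continuous fun t : ℝ ↦ ∫ s in (0 : ℝ)..t, f (projIcc 0 1 zero_le_one s) :=
          intervalIntegral.continuous_primitive (fun a b ↦
            (f.continuous.comp continuous_projIcc).intervalIntegrable a b) 0
        exact this.comp continuous_subtype_val⟩
      map_add' := fun f g ↦ by
        ext t
        exact intervalIntegral.integral_add
          ((f.continuous.comp continuous_projIcc).intervalIntegrable _ _)
          ((g.continuous.comp continuous_projIcc).intervalIntegrable _ _)
      map_smul' := fun c f ↦ by
        ext t
        exact intervalIntegral.integral_smul c _ } 1
    (fun f ↦ by
      rw [one_mul]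
      refine (ContinuousMap.norm_le _ (by positivity)).2 fun t ↦ ?_
      have := intervalIntegral.norm_integral_le_of_norm_le_const (a := (0 : ℝ)) (b := t)
        (f := fun s ↦ f (projIcc 0 1 zero_le_one s)) (C := ‖f‖)
        (fun s _ ↦ ContinuousMap.norm_coe_le_norm f _)
      refine this.trans ?_
      rw [sub_zero, abs_of_nonneg t.2.1]
      exact mul_le_of_le_one_right (norm_nonneg _) t.2.2)

lemma primitiveL_apply (f : C(unitInterval, K)) (t : unitInterval) :
    primitiveL f t = ∫ s in (0 : ℝ)..t, f (projIcc 0 1 zero_le_one s) := rfl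

lemma primitiveL_eq_sub [CompleteSpace K] {f : C(unitInterval, K)} {c : ℝ → K}
    (hc : ∀ s (hs : s ∈ Icc (0 : ℝ) 1), HasDerivAt c (f ⟨s, hs⟩) s) (t : unitInterval) :
    primitiveL f t = c t - c 0 := by
  rw [primitiveL_apply]
  refine intervalIntegral.integral_eq_sub_of_hasDerivAt (fun s hs ↦ ?_)
    ((f.continuous.comp continuous_projIcc).intervalIntegrable _ _)
  rw [uIcc_of_le t.2.1] at hs
  have hs' : s ∈ Icc (0 : ℝ) 1 := ⟨hs.1, hs.2.trans t.2.2⟩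
  rw [projIcc_of_mem zero_le_one hs']
  exact hc s hs'

/-- `projIcc` extends `f` by constants to the whole line, so the primitive has a two-sided
derivative even at the end points. -/
lemma exists_hasDerivAt_primitiveL [CompleteSpace K] (f : C(unitInterval, K)) :
    ∃ c : ℝ → K, (∀ s (hs : s ∈ Icc (0 : ℝ) 1), HasDerivAt c (f ⟨s, hs⟩) s) ∧
      ∀ t : unitInterval, c t = primitiveL f t := by
  refine ⟨fun t ↦ ∫ s in (0 : ℝ)..t, f (projIcc 0 1 zero_le_one s), fun s hs ↦ ?_, fun _ ↦ rfl⟩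
  have := (f.continuous.comp (continuous_projIcc (h := zero_le_one))).integral_hasStrictDerivAt 0 s
  rw [← projIcc_of_mem zero_le_one hs]
  exact this.hasDerivAt

end Primitive

/-! ### The radial equation and its linearisation -/

section Frobenius

universe u


variable {H K : Type u} [NormedAddCommGroup H] [NormedSpace ℝ H] [FiniteDimensional ℝ H]
  [NormedAddCommGroup K] [NormedSpace ℝ K] [FiniteDimensional ℝ K]

/-- The map sending `((x, y), γ)` to the path `t ↦ ((t x, γ t), x)`. -/
def radialPathL (H K : Type u) [NormedAddCommGroup H] [NormedSpace ℝ H] [FiniteDimensional ℝ H]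
    [NormedAddCommGroup K] [NormedSpace ℝ K] :
    ((H × K) × C(unitInterval, K)) →L[ℝ] C(unitInterval, (H × K) × H) :=
  let a : H →L[ℝ] C(unitInterval, (H × K) × H) := LinearMap.toContinuousLinearMap
    { toFun := fun x ↦ ⟨fun t ↦ (((t : ℝ) • x, 0), x), by fun_prop⟩
      map_add' := fun x y ↦ by ext t <;> simp
      map_smul' := fun c x ↦ by ext t <;> simp [smul_comm c] }
  let b : C(unitInterval, K) →L[ℝ] C(unitInterval, (H × K) × H) :=
    ContinuousLinearMap.compLeftContinuous ℝ unitInterval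
      ((ContinuousLinearMap.inl ℝ (H × K) H).comp (ContinuousLinearMap.inr ℝ H K))
  a.comp ((ContinuousLinearMap.fst ℝ H K).comp (ContinuousLinearMap.fst ℝ _ _)) +
    b.comp (ContinuousLinearMap.snd ℝ _ _)

@[simp]
lemma radialPathL_apply (p : (H × K) × C(unitInterval, K)) (t : unitInterval) :
    radialPathL H K p t = (((t : ℝ) • p.1.1, p.2 t), p.1.1) := by
  ext <;> simp [radialPathL]

/-- The constant path. -/
def constPathL (K : Type u) [NormedAddCommGroup K] [NormedSpace ℝ K] [FiniteDimensional ℝ K] :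
    K →L[ℝ] C(unitInterval, K) :=
  LinearMap.toContinuousLinearMap
    { toFun := ContinuousMap.const _
      map_add' := fun _ _ ↦ rfl
      map_smul' := fun _ _ ↦ rfl }

@[simp]
lemma constPathL_apply (y : K) (t : unitInterval) : constPathL K y t = y := rfl

/-- Evaluation of a path at the end point. -/
def evalOneL (K : Type u) [NormedAddCommGroup K] [NormedSpace ℝ K] :
    C(unitInterval, K) →L[ℝ] K := ContinuousMap.evalCLM ℝ 1

@[simp]
lemma evalOneL_apply (γ : C(unitInterval, K)) : evalOneL K γ = γ 1 := rfl

variable {A : H × K → H →L[ℝ] K}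

/-- The right-hand side of the radial equation. -/
def radialRHS (hA : ContDiff ℝ ∞ A) : C((H × K) × H, K) :=
  ⟨fun p ↦ A p.1 p.2, (hA.continuous.comp continuous_fst).clm_apply continuous_snd⟩

@[simp]
lemma radialRHS_apply (hA : ContDiff ℝ ∞ A) (p : (H × K) × H) :
    radialRHS hA p = A p.1 p.2 := rfl

lemma contDiff_radialRHS (hA : ContDiff ℝ ∞ A) : ContDiff ℝ ∞ (radialRHS hA) :=
  (hA.comp contDiff_fst).clm_apply contDiff_snd

lemma fderiv_radialRHS (hA : ContDiff ℝ ∞ A) (p q : (H × K) × H) :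
    fderiv ℝ (radialRHS hA) p q = fderiv ℝ A p.1 q.1 p.2 + A p.1 q.2 := by
  have h1 : HasFDerivAt A (fderiv ℝ A p.1) p.1 := (hA.differentiable (by simp) _).hasFDerivAt
  have h2 := (h1.comp p hasFDerivAt_fst).clm_apply (hasFDerivAt_snd (𝕜 := ℝ) (p := p))
  have h3 : HasFDerivAt (radialRHS hA) _ p := h2
  rw [h3.fderiv]
  simp [add_comm]

/-- The integral form of the radial equation `γ' = A (t x, γ) x`, `γ 0 = y`: the path `γ` is a
solution if and only if it is fixed by this operator. -/
def radialOperator (hA : ContDiff ℝ ∞ A) (p : (H × K) × C(unitInterval, K)) :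
    C(unitInterval, K) :=
  constPathL K p.1.2 + primitiveL ((radialRHS hA).comp (radialPathL H K p))

lemma contDiff_radialOperator (hA : ContDiff ℝ ∞ A) : ContDiff ℝ ∞ (radialOperator hA) := by
  have h1 : ContDiff ℝ ∞ fun p : (H × K) × C(unitInterval, K) ↦ constPathL K p.1.2 :=
    (constPathL K).contDiff.comp (contDiff_snd.comp contDiff_fst)
  have h2 : ContDiff ℝ ∞ fun p : (H × K) × C(unitInterval, K) ↦
      (radialRHS hA).comp (radialPathL H K p) :=
    (contDiff_postcomp _ (contDiff_radialRHS hA)).comp (radialPathL H K).contDiff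
  exact h1.add ((primitiveL (K := K)).contDiff.comp h2)

lemma fderiv_radialOperator (hA : ContDiff ℝ ∞ A) (p q : (H × K) × C(unitInterval, K)) :
    fderiv ℝ (radialOperator hA) p q = constPathL K q.1.2 +
      primitiveL (fderiv ℝ (fun γ : C(unitInterval, (H × K) × H) ↦ (radialRHS hA).comp γ)
        (radialPathL H K p) (radialPathL H K q)) := by
  have h0 : HasFDerivAt (fun p : (H × K) × C(unitInterval, K) ↦ constPathL K p.1.2)
      ((constPathL K).comp ((ContinuousLinearMap.snd ℝ H K).comp
        (ContinuousLinearMap.fst ℝ _ _))) p :=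
    ((constPathL K).comp ((ContinuousLinearMap.snd ℝ H K).comp
        (ContinuousLinearMap.fst ℝ (H × K) C(unitInterval, K)))).hasFDerivAt
  have h1 := ((contDiff_postcomp (X := unitInterval) _ (contDiff_radialRHS hA)).differentiable
    (by simp) (radialPathL H K p)).hasFDerivAt
  have h2 := h1.comp p (radialPathL H K).hasFDerivAt
  have h3 := (primitiveL (K := K)).hasFDerivAt.comp p h2
  have h4 : HasFDerivAt (radialOperator hA) _ p := h0.add h3
  rw [h4.fderiv]
  rfl

/-- The map whose local inverse solves the radial equation. -/
def radialMap (hA : ContDiff ℝ ∞ A) (p : (H × K) × C(unitInterval, K)) :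
    (H × K) × C(unitInterval, K) := (p.1, p.2 - radialOperator hA p)

lemma contDiff_radialMap (hA : ContDiff ℝ ∞ A) : ContDiff ℝ ∞ (radialMap hA) :=
  contDiff_fst.prodMk (contDiff_snd.sub (contDiff_radialOperator hA))

lemma hasFDerivAt_radialMap (hA : ContDiff ℝ ∞ A) (p : (H × K) × C(unitInterval, K)) :
    HasFDerivAt (radialMap hA) ((ContinuousLinearMap.fst ℝ _ _).prod
      (ContinuousLinearMap.snd ℝ _ _ - fderiv ℝ (radialOperator hA) p)) p :=
  hasFDerivAt_fst.prodMk (hasFDerivAt_snd.sub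
    ((contDiff_radialOperator hA).differentiable (by simp) p).hasFDerivAt)

/-- At `x = 0` the right-hand side `A (t x, γ) x` vanishes for every `γ`, so the derivative `R` of
the operator ignores the path variable. The derivative of `radialMap` is therefore unipotent, and
changing the sign of `R` inverts it. -/
lemma exists_equiv_hasFDerivAt_radialMap (hA : ContDiff ℝ ∞ A) (y : K) :
    ∃ D : ((H × K) × C(unitInterval, K)) ≃L[ℝ] ((H × K) × C(unitInterval, K)),
      HasFDerivAt (radialMap hA)
        (D : ((H × K) × C(unitInterval, K)) →L[ℝ] ((H × K) × C(unitInterval, K)))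
        ((0, y), constPathL K y) := by
  set p : (H × K) × C(unitInterval, K) := ((0, y), constPathL K y)
  set R := fderiv ℝ (radialOperator hA) p with hR
  have hR0 : ∀ γ : C(unitInterval, K), R (0, γ) = 0 := by
    intro γ
    have : fderiv ℝ (fun γ : C(unitInterval, (H × K) × H) ↦ (radialRHS hA).comp γ)
        (radialPathL H K p) (radialPathL H K (0, γ)) = 0 := by
      ext t
      rw [fderiv_postcomp_apply _ (contDiff_radialRHS hA), fderiv_radialRHS]
      simp [p]
    rw [hR, fderiv_radialOperator, this]
    simp
  let D₁ := (ContinuousLinearMap.fst ℝ (H × K) C(unitInterval, K)).prod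
      (ContinuousLinearMap.snd ℝ _ _ - R)
  let D₂ := (ContinuousLinearMap.fst ℝ (H × K) C(unitInterval, K)).prod
      (ContinuousLinearMap.snd ℝ _ _ + R)
  have hsplit : ∀ (z : H × K) (γ δ : C(unitInterval, K)), R (z, γ + δ) = R (z, γ) := by
    intro z γ δ
    have : (z, γ + δ) = (z, γ) + (0, δ) := by simp
    rw [this, map_add, hR0, add_zero]
  refine ⟨ContinuousLinearEquiv.equivOfInverse D₁ D₂ ?_ ?_, hasFDerivAt_radialMap hA p⟩
  · rintro ⟨z, γ⟩
    simp [D₁, D₂, sub_eq_add_neg, hsplit]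
  · rintro ⟨z, γ⟩
    simp [D₁, D₂, hsplit]

/-- Along a solution of the radial equation, the field `t ↦ t A (t x, γ t) u` solves the equation
of variations, provided that the integrability condition holds along the solution. -/
lemma fderiv_radialOperator_of_symmetric (hA : ContDiff ℝ ∞ A)
    {p : (H × K) × C(unitInterval, K)} (hp : p.2 = radialOperator hA p) (u : H)
    (hsymm : ∀ t : unitInterval, ∀ v w : H,
      fderiv ℝ A ((t : ℝ) • p.1.1, p.2 t) (v, A ((t : ℝ) • p.1.1, p.2 t) v) w =
      fderiv ℝ A ((t : ℝ) • p.1.1, p.2 t) (w, A ((t : ℝ) • p.1.1, p.2 t) w) v)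
    {B : C(unitInterval, K)} (hB : ∀ t : unitInterval,
      B t = (t : ℝ) • A ((t : ℝ) • p.1.1, p.2 t) u) :
    fderiv ℝ (radialOperator hA) p ((u, 0), B) = B := by
  obtain ⟨⟨x, y⟩, γ⟩ := p
  dsimp only at hp hsymm hB
  obtain ⟨c₀, hc₀, hc₀'⟩ :=
    exists_hasDerivAt_primitiveL ((radialRHS hA).comp (radialPathL H K ((x, y), γ)))
  have hγ : ∀ t : unitInterval, γ t = y + c₀ t := fun t ↦ by
    rw [hc₀', congrArg (fun f : C(unitInterval, K) ↦ f t) hp]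
    simp [radialOperator]
  rw [fderiv_radialOperator]
  ext t
  simp only [map_zero, zero_add]
  -- The proposed antiderivative is `B` itself. The product rule gives `A u + s • dA (x, A x) u`,
  -- while the linearised equation asks for `A u + s • dA (u, A u) x`; the integrability condition
  -- equates them.
  rw [primitiveL_eq_sub (c := fun s ↦ s • A (s • x, y + c₀ s) u)]
  · simp [hB, hγ]
  · intro s hs
    set τ : unitInterval := ⟨s, hs⟩ with hτ
    rw [fderiv_postcomp_apply _ (contDiff_radialRHS hA), fderiv_radialRHS]
    have hs' : y + c₀ s = γ τ := (hγ τ).symm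
    have hc : HasDerivAt c₀ (A (s • x, γ τ) x) s := by
      simpa [hτ] using hc₀ s hs
    have h1 : HasDerivAt (fun s : ℝ ↦ (s • x, y + c₀ s)) (x, A (s • x, γ τ) x) s :=
      HasDerivAt.prodMk (by simpa using (hasDerivAt_id s).smul_const x) (hc.const_add y)
    have h2 : HasFDerivAt A (fderiv ℝ A (s • x, y + c₀ s)) (s • x, y + c₀ s) :=
      (hA.differentiable (by simp) _).hasFDerivAt
    have h3 : HasDerivAt (fun s : ℝ ↦ A (s • x, y + c₀ s))
        (fderiv ℝ A (s • x, y + c₀ s) (x, A (s • x, γ τ) x)) s :=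
      h2.comp_hasDerivAt s h1
    have h4 : HasDerivAt (fun s : ℝ ↦ A (s • x, y + c₀ s) u)
        (fderiv ℝ A (s • x, y + c₀ s) (x, A (s • x, γ τ) x) u) s := by
      simpa using h3.clm_apply (hasDerivAt_const s u)
    have h5 := (hasDerivAt_id s).smul h4
    refine h5.congr_deriv ?_
    have hpair : (s • u, B τ) = s • (u, A (s • x, γ τ) u) := by
      rw [hB]; rfl
    rw [radialPathL_apply, radialPathL_apply, hs']
    dsimp only [id]
    rw [show (τ : ℝ) = s from rfl, hpair, map_smul, one_smul, smul_apply]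
    congr 2
    exact hsymm τ x u

end Frobenius

/-! ### Total differential equations and flattening of graphs -/

section Frobenius

universe u

variable {H K : Type u} [NormedAddCommGroup H] [NormedSpace ℝ H] [FiniteDimensional ℝ H]
  [NormedAddCommGroup K] [NormedSpace ℝ K] [FiniteDimensional ℝ K] {A : H × K → H →L[ℝ] K}

/-- The integrability condition, at the point `p`, for the distribution of the graphs of `A`. -/
def IsSymmetricAt (A : H × K → H →L[ℝ] K) (p : H × K) : Prop :=
  ∀ v w : H, fderiv ℝ A p (v, A p v) w = fderiv ℝ A p (w, A p w) v

/-- The total differential equation `∂Φ/∂x = A (x, Φ)`, `Φ (0, y) = y`, has a smooth local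
solution. -/
lemma exists_solution_totalDifferentialEquation (hA : ContDiff ℝ ∞ A) {O : Set (H × K)} {y₀ : K}
    (hO : O ∈ 𝓝 ((0, y₀) : H × K)) (hsymm : ∀ p ∈ O, IsSymmetricAt A p) :
    ∃ (W : Set (H × K)) (Φ : H × K → K), IsOpen W ∧ (0, y₀) ∈ W ∧ ContDiffOn ℝ ∞ Φ W ∧
      (∀ y, (0, y) ∈ W → Φ (0, y) = y) ∧
      ∀ z ∈ W, ∀ u : H, fderiv ℝ Φ z (u, 0) = A (z.1, Φ z) u := by
  obtain ⟨D₀, hD₀⟩ := exists_equiv_hasFDerivAt_radialMap hA y₀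
  obtain ⟨e, hae, -, hcoe, hsm, hder⟩ := exists_openPartialHomeomorph_of_hasFDerivAt_equiv
    isOpen_univ (contDiff_radialMap hA).contDiffOn (mem_univ _) hD₀
  set p₀ : (H × K) × C(unitInterval, K) := ((0, y₀), constPathL K y₀) with hp₀
  have hzero : ∀ y : K, radialMap hA ((0, y), constPathL K y) = ((0, y), 0) := by
    intro y
    refine Prod.ext rfl ?_
    ext t
    simp [radialMap, radialOperator, primitiveL_apply]
  obtain ⟨δ, hδ, hball⟩ := Metric.mem_nhds_iff.1 hO
  let j : H × K → (H × K) × C(unitInterval, K) := fun z ↦ (z, 0)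
  have hj : ContDiff ℝ ∞ j := contDiff_id.prodMk contDiff_const
  -- Solutions are the preimages of `(z, 0)` under `radialMap`. Staying within `δ` of `p₀` keeps the
  -- whole curve `(t x, γ t)` inside `O`, where the integrability condition is available.
  let W₀ := j ⁻¹' (e.symm.source ∩ e.symm ⁻¹' (e.source ∩ Metric.ball p₀ δ))
  have hW₀ : IsOpen W₀ :=
    (e.symm.isOpen_inter_preimage (e.open_source.inter Metric.isOpen_ball)).preimage
      hj.continuous
  let q : H × K → (H × K) × C(unitInterval, K) := fun z ↦ e.symm (z, 0)
  have hqp₀ : q (0, y₀) = p₀ := by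
    have : e p₀ = ((0, y₀), 0) := by rw [hcoe]; exact hzero y₀
    show e.symm _ = _
    rw [← this, e.left_inv hae]
  have hW₀mem : (0, y₀) ∈ W₀ := by
    refine ⟨?_, ?_⟩
    · have := e.map_source hae
      rw [hcoe] at this
      rwa [hzero y₀] at this
    · show q (0, y₀) ∈ e.source ∩ Metric.ball p₀ δ
      rw [hqp₀]
      exact ⟨hae, Metric.mem_ball_self hδ⟩
  -- The extra condition places the constant path, which solves the equation for `x = 0`, in the
  -- source. The local inverse then returns that path, whence `Φ (0, y) = y`.
  let W := W₀ ∩ {z | ((0, z.2), constPathL K z.2) ∈ e.source}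
  have hW : IsOpen W := by
    refine hW₀.inter (e.open_source.preimage (f := fun z : H × K ↦
      (((0 : H), z.2), constPathL K z.2)) ?_)
    fun_prop
  have hqsm : ContDiffOn ℝ ∞ q W := fun z hz ↦
    ((hsm _ hz.1.1).contDiffAt (e.open_target.mem_nhds hz.1.1)).comp z hj.contDiffAt
      |>.contDiffWithinAt
  have hright : ∀ z ∈ W, radialMap hA (q z) = (z, 0) := by
    intro z hz
    have := e.right_inv hz.1.1
    rwa [hcoe] at this
  have hfst : ∀ z ∈ W, (q z).1 = z := fun z hz ↦ congrArg Prod.fst (hright z hz)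
  have hfix : ∀ z ∈ W, (q z).2 = radialOperator hA (q z) := fun z hz ↦
    sub_eq_zero.1 (congrArg Prod.snd (hright z hz))
  refine ⟨W, fun z ↦ (q z).2 1, hW, ⟨hW₀mem, hae⟩, ?_, ?_, ?_⟩
  · exact (evalOneL K).contDiff.comp_contDiffOn (contDiff_snd.comp_contDiffOn hqsm)
  · intro y hy
    have h1 : e ((0, y), constPathL K y) = ((0, y), 0) := by rw [hcoe]; exact hzero y
    have h2 : q (0, y) = ((0, y), constPathL K y) := by
      show e.symm _ = _
      rw [← h1, e.left_inv hy.2]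
    simp [h2]
  · intro z hz u
    have hqz : q z ∈ e.source := hz.1.2.1
    have hqδ : q z ∈ Metric.ball p₀ δ := hz.1.2.2
    obtain ⟨D, hD⟩ := hder _ hqz
    have hq' : HasFDerivAt q (fderiv ℝ q z) z :=
      (((hqsm z hz).contDiffAt (hW.mem_nhds hz)).differentiableAt (by simp)).hasFDerivAt
    have hcomp : HasFDerivAt (fun z ↦ radialMap hA (q z))
        ((D : _ →L[ℝ] _).comp (fderiv ℝ q z)) z := hD.comp z hq'
    have hcomp' : HasFDerivAt (fun z ↦ radialMap hA (q z))
        ((ContinuousLinearMap.id ℝ (H × K)).prod 0) z :=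
      ((hasFDerivAt_id z).prodMk (hasFDerivAt_const _ z)).congr_of_eventuallyEq
        (Filter.eventuallyEq_of_mem (hW.mem_nhds hz) hright)
    have hDq : D (fderiv ℝ q z (u, 0)) = ((u, 0), 0) :=
      congrArg (fun T : (H × K) →L[ℝ] _ ↦ T (u, 0)) (hcomp.unique hcomp')
    let B : C(unitInterval, K) :=
      ⟨fun t ↦ (t : ℝ) • A ((t : ℝ) • (q z).1.1, (q z).2 t) u, by
        have := hA.continuous
        fun_prop⟩
    have hin : ∀ t : unitInterval, ((t : ℝ) • (q z).1.1, (q z).2 t) ∈ O := by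
      intro t
      apply hball
      rw [Metric.mem_ball, dist_eq_norm] at hqδ ⊢
      refine lt_of_le_of_lt ?_ hqδ
      rw [Prod.norm_def]
      refine max_le ?_ ?_
      · simp only [Prod.fst_sub, sub_zero, norm_smul, Real.norm_eq_abs, abs_of_nonneg t.2.1]
        calc (t : ℝ) * ‖(q z).1.1‖ ≤ 1 * ‖(q z).1.1‖ := by gcongr; exact t.2.2
          _ = ‖(q z - p₀).1.1‖ := by simp [p₀]
          _ ≤ _ := (norm_fst_le _).trans (norm_fst_le _)
      · calc ‖(q z).2 t - y₀‖ = ‖(q z - p₀).2 t‖ := rfl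
          _ ≤ _ := (ContinuousMap.norm_coe_le_norm _ t).trans (norm_snd_le _)
    have hDB : D ((u, 0), B) = ((u, 0), 0) := by
      have h1 := congrArg (fun T : ((H × K) × C(unitInterval, K)) →L[ℝ] _ ↦ T ((u, 0), B))
        (hD.unique (hasFDerivAt_radialMap hA (q z)))
      have h2 := fderiv_radialOperator_of_symmetric hA (hfix z hz) u
        (fun t ↦ hsymm _ (hin t)) (B := B) (fun t ↦ rfl)
      simpa [h2] using h1
    -- Both vectors are sent by the invertible `D` to `((u, 0), 0)`: one by differentiating
    -- `radialMap (q z) = (z, 0)`, the other by the equation of variations.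
    have hval : fderiv ℝ q z (u, 0) = ((u, 0), B) := D.injective (hDq.trans hDB.symm)
    have hΦ : HasFDerivAt (fun z ↦ (q z).2 1)
        (((evalOneL K).comp (ContinuousLinearMap.snd ℝ (H × K) _)).comp (fderiv ℝ q z)) z :=
      ((evalOneL K).comp (ContinuousLinearMap.snd ℝ (H × K) _)).hasFDerivAt.comp z hq'
    rw [hΦ.fderiv]
    simp only [ContinuousLinearMap.comp_apply, hval, ContinuousLinearMap.coe_snd', evalOneL_apply]
    simp [B, hfst z hz]

/-- **Frobenius theorem** for the distribution of the graphs of a smooth field of linear maps: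
if the integrability condition holds, then the distribution is horizontal in suitable smooth
coordinates. -/
theorem exists_flat_coordinates_graph (hA : ContDiff ℝ ∞ A) {O : Set (H × K)} {y₀ : K}
    (hO : O ∈ 𝓝 ((0, y₀) : H × K)) (hsymm : ∀ p ∈ O, IsSymmetricAt A p) :
    ∃ e : OpenPartialHomeomorph (H × K) (H × K), (0, y₀) ∈ e.source ∧
      ContDiffOn ℝ ∞ e e.source ∧ ContDiffOn ℝ ∞ e.symm e.target ∧
      ∀ p ∈ e.source, ∀ w : H × K, w.2 = A p w.1 ↔ (fderiv ℝ e p w).2 = 0 := by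
  obtain ⟨W, Φ, hW, h0W, hΦ, hΦ0, hdΦ⟩ := exists_solution_totalDifferentialEquation hA hO hsymm
  let Ψ : H × K → H × K := fun z ↦ (z.1, Φ z)
  have hΨ : ContDiffOn ℝ ∞ Ψ W := contDiffOn_fst.prodMk hΦ
  have hΦ' : ∀ z ∈ W, HasFDerivAt Φ (fderiv ℝ Φ z) z := fun z hz ↦
    (((hΦ z hz).contDiffAt (hW.mem_nhds hz)).differentiableAt (by simp)).hasFDerivAt
  have hΨ' : ∀ z ∈ W, HasFDerivAt Ψ ((ContinuousLinearMap.fst ℝ H K).prod (fderiv ℝ Φ z)) z :=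
    fun z hz ↦ hasFDerivAt_fst.prodMk (hΦ' z hz)
  have hvert : ∀ v : K, fderiv ℝ Φ (0, y₀) (0, v) = v := by
    intro v
    have h1 : HasFDerivAt (fun y : K ↦ ((0 : H), y)) (ContinuousLinearMap.inr ℝ H K) y₀ :=
      (ContinuousLinearMap.inr ℝ H K).hasFDerivAt
    have h2 : HasFDerivAt (fun y : K ↦ Φ (0, y))
        ((fderiv ℝ Φ (0, y₀)).comp (ContinuousLinearMap.inr ℝ H K)) y₀ :=
      HasFDerivAt.comp y₀ (hΦ' _ h0W) h1
    have h3 : HasFDerivAt (fun y : K ↦ Φ (0, y)) (ContinuousLinearMap.id ℝ K) y₀ :=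
      (hasFDerivAt_id y₀).congr_of_eventuallyEq <| Filter.eventuallyEq_of_mem
        (h1.continuousAt.preimage_mem_nhds (hW.mem_nhds h0W)) (fun y hy ↦ hΦ0 y hy)
    exact congrArg (fun T : K →L[ℝ] K ↦ T v) (h2.unique h3)
  have hsplit : ∀ w : H × K, fderiv ℝ Φ (0, y₀) w = fderiv ℝ Φ (0, y₀) (w.1, 0) + w.2 := by
    intro w
    have : w = (w.1, 0) + (0, w.2) := by simp
    conv_lhs => rw [this, map_add, hvert]
  let D₁ := (ContinuousLinearMap.fst ℝ H K).prod (fderiv ℝ Φ (0, y₀))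
  let D₂ := (ContinuousLinearMap.fst ℝ H K).prod (ContinuousLinearMap.snd ℝ H K -
    (fderiv ℝ Φ (0, y₀)).comp ((ContinuousLinearMap.inl ℝ H K).comp
      (ContinuousLinearMap.fst ℝ H K)))
  let D : (H × K) ≃L[ℝ] (H × K) := ContinuousLinearEquiv.equivOfInverse D₁ D₂
    (fun w ↦ by
      refine Prod.ext rfl ?_
      show fderiv ℝ Φ (0, y₀) w - fderiv ℝ Φ (0, y₀) (w.1, 0) = w.2
      rw [hsplit w, add_sub_cancel_left]) (fun w ↦ by
      refine Prod.ext rfl ?_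
      show fderiv ℝ Φ (0, y₀) (w.1, w.2 - fderiv ℝ Φ (0, y₀) (w.1, 0)) = w.2
      rw [hsplit, add_sub_cancel])
  obtain ⟨e, h0e, heW, hcoe, hsm, hder⟩ := exists_openPartialHomeomorph_of_hasFDerivAt_equiv
    hW hΨ h0W (f' := D) (hΨ' _ h0W)
  have hΨ0 : e (0, y₀) = (0, y₀) := by
    rw [hcoe]
    exact Prod.ext rfl (hΦ0 y₀ h0W)
  refine ⟨e.symm, ?_, hsm, ?_, ?_⟩
  · rw [← hΨ0]
    exact e.map_source h0e
  · rw [e.symm_symm, hcoe]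
    exact hΨ.mono heW
  · intro p hp w
    set z := e.symm p with hz
    have hzs : z ∈ e.source := e.map_target hp
    obtain ⟨T, hT⟩ := hder z hzs
    have hzp : Ψ z = p := by rw [← hcoe]; exact e.right_inv hp
    have hsymm' : HasFDerivAt e.symm (T.symm : (H × K) →L[ℝ] (H × K)) p :=
      e.hasFDerivAt_symm hp (by rw [hcoe]; exact hT)
    -- The differential equation for `Φ` says that the derivative of `Ψ` carries the horizontal
    -- space onto the graph of `A p`.
    have hTu : ∀ u : H, T (u, 0) = (u, A p u) := by
      intro u
      have := congrArg (fun T : (H × K) →L[ℝ] (H × K) ↦ T (u, 0)) (hT.unique (hΨ' z (heW hzs)))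
      refine this.trans (Prod.ext rfl ?_)
      exact (hdΦ z (heW hzs) u).trans (by rw [← hzp])
    rw [hsymm'.fderiv]
    constructor
    · intro h
      have : w = T (w.1, 0) := by rw [hTu, ← h]
      rw [this]
      simp
    · intro h
      have h1 : T.symm w = ((T.symm w).1, 0) := Prod.ext rfl h
      have h2 : w = (((T.symm w).1), A p (T.symm w).1) := by
        rw [← hTu, ← h1, T.apply_symm_apply]
      rw [h2]

end Frobenius

/-! ### Global extension of germs -/

section Extension

variable {E F : Type*} [NormedAddCommGroup E] [NormedSpace ℝ E] [FiniteDimensional ℝ E]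
  [NormedAddCommGroup F] [NormedSpace ℝ F]

/-- A smooth function on an open set agrees near each point with a globally smooth function. -/
lemma exists_contDiff_eventuallyEq {f : E → F} {U : Set E} (hU : IsOpen U)
    (hf : ContDiffOn ℝ ∞ f U) {a : E} (ha : a ∈ U) :
    ∃ g : E → F, ContDiff ℝ ∞ g ∧ g =ᶠ[𝓝 a] f := by
  obtain ⟨δ, hδ, hball⟩ := Metric.nhds_basis_closedBall.mem_iff.1 (hU.mem_nhds ha)
  let φ : ContDiffBump a := ⟨δ / 2, δ, by positivity, by linarith⟩
  refine ⟨fun x ↦ φ x • f x, contDiff_iff_contDiffAt.2 fun x ↦ ?_, ?_⟩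
  · by_cases hx : x ∈ U
    · exact φ.contDiffAt.smul ((hf x hx).contDiffAt (hU.mem_nhds hx))
    · have h1 : x ∉ tsupport φ := fun h ↦ hx (hball (by rwa [φ.tsupport_eq] at h))
      have h2 : (fun x ↦ φ x • f x) =ᶠ[𝓝 x] fun _ ↦ 0 := by
        filter_upwards [notMem_tsupport_iff_eventuallyEq.1 h1] with y hy
        simp [hy]
      exact contDiffAt_const.congr_of_eventuallyEq h2
  · filter_upwards [φ.eventuallyEq_one] with x hx
    simp [hx]

end Extension

/-! ### Kernels of two-forms and Lie brackets -/

section TwoForms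

universe u

variable {F : Type u} [NormedAddCommGroup F] [NormedSpace ℝ F]

/-- The exterior derivative of a field of bilinear forms on a normed space. -/
def extDerivBilin (Θ : F → F →L[ℝ] F →L[ℝ] ℝ) (z a b c : F) : ℝ :=
  fderiv ℝ Θ z a b c + fderiv ℝ Θ z b c a + fderiv ℝ Θ z c a b

/-- The kernel of a two-form is closed under Lie brackets, at the points at which the exterior
derivative vanishes on pairs of vectors in the kernel. -/
lemma apply_lieBracket_eq_zero {Θ : F → F →L[ℝ] F →L[ℝ] ℝ} {z : F} (hΘ : DifferentiableAt ℝ Θ z)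
    (halt : ∀ᶠ y in 𝓝 z, ∀ a b, Θ y a b = -Θ y b a)
    {X Y : F → F} (hX : DifferentiableAt ℝ X z) (hY : DifferentiableAt ℝ Y z)
    (hΘX : ∀ᶠ y in 𝓝 z, Θ y (X y) = 0) (hΘY : ∀ᶠ y in 𝓝 z, Θ y (Y y) = 0)
    (hd : ∀ c, extDerivBilin Θ z (X z) (Y z) c = 0) :
    Θ z (VectorField.lieBracket ℝ X Y z) = 0 := by
  -- Differentiating `Θ (Z) = 0` trades derivatives of `Θ` for derivatives of the field.
  have hdiff : ∀ {Z : F → F}, DifferentiableAt ℝ Z z → (∀ᶠ y in 𝓝 z, Θ y (Z y) = 0) →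
      ∀ h b, fderiv ℝ Θ z h (Z z) b = -Θ z (fderiv ℝ Z z h) b := by
    intro Z hZ hΘZ h b
    have h1 := hΘ.hasFDerivAt.clm_apply hZ.hasFDerivAt
    have h2 : HasFDerivAt (fun y ↦ Θ y (Z y)) (0 : F →L[ℝ] F →L[ℝ] ℝ) z :=
      (hasFDerivAt_const (0 : F →L[ℝ] ℝ) z).congr_of_eventuallyEq hΘZ
    have h3 := congrArg (fun T : F →L[ℝ] F →L[ℝ] ℝ ↦ T h b) (h1.unique h2)
    simp at h3
    linarith
  have halt' : ∀ h a b, fderiv ℝ Θ z h a b = -fderiv ℝ Θ z h b a := by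
    intro h a b
    have h1 : ∀ a b, HasFDerivAt (fun y ↦ Θ y a b) _ z := fun a b ↦
      (hΘ.hasFDerivAt.clm_apply (hasFDerivAt_const a z)).clm_apply (hasFDerivAt_const b z)
    have h2 := (h1 b a).neg.congr_of_eventuallyEq (f₁ := fun y ↦ Θ y a b)
      (halt.mono fun y hy ↦ hy a b)
    simpa using congrArg (fun T : F →L[ℝ] ℝ ↦ T h) ((h1 a b).unique h2)
  ext c
  have h1 := hd c
  have h2 := halt.self_of_nhds (fderiv ℝ X z c) (Y z)
  rw [hΘY.self_of_nhds] at h2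
  -- The first two cyclic terms combine to minus `Θ` of the bracket evaluated at `c`. The third is
  -- `-Θ (DX c) Y`, zero because `Y` is in the kernel.
  rw [extDerivBilin, hdiff hY hΘY, halt' (Y z) c, hdiff hX hΘX, hdiff hX hΘX, h2] at h1
  simp only [zero_apply, neg_zero, add_zero, neg_neg] at h1
  simp only [VectorField.lieBracket, map_sub, sub_apply,
    zero_apply]
  linarith

end TwoForms

/-! ### Writing the kernel as a graph -/

section GraphForm

universe u

variable {H K : Type u} [NormedAddCommGroup H] [NormedSpace ℝ H] [FiniteDimensional ℝ H]
  [NormedAddCommGroup K] [NormedSpace ℝ K] [FiniteDimensional ℝ K]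

/-- The kernel of a two-form of constant rank is locally the distribution of graphs of a
smooth field of linear maps. -/
lemma exists_ker_eq_graph {Θ : H × K → (H × K) →L[ℝ] (H × K) →L[ℝ] ℝ} {U : Set (H × K)}
    (hU : IsOpen U) (h0 : 0 ∈ U) (hΘ : ContDiffOn ℝ ∞ Θ U)
    (halt : ∀ z ∈ U, ∀ a b, Θ z a b = -Θ z b a)
    (hker : ∀ v : H × K, Θ 0 v = 0 ↔ v.2 = 0)
    (hrank : ∀ z ∈ U, Module.finrank ℝ (LinearMap.ker (Θ z).toLinearMap) = Module.finrank ℝ H) :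
    ∃ A : H × K → H →L[ℝ] K, ContDiff ℝ ∞ A ∧
      ∀ᶠ z in 𝓝 0, z ∈ U ∧ ∀ v : H × K, Θ z v = 0 ↔ v.2 = A z v.1 := by
  let restr : ((H × K) →L[ℝ] ℝ) →L[ℝ] (K →L[ℝ] ℝ) :=
    (ContinuousLinearMap.compL ℝ K (H × K) ℝ).flip (ContinuousLinearMap.inr ℝ H K)
  let P : H × K → K →L[ℝ] (K →L[ℝ] ℝ) := fun z ↦
    restr.comp ((Θ z).comp (ContinuousLinearMap.inr ℝ H K))
  let Q : H × K → H →L[ℝ] (K →L[ℝ] ℝ) := fun z ↦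
    restr.comp ((Θ z).comp (ContinuousLinearMap.inl ℝ H K))
  have hP : ContDiffOn ℝ ∞ P U := contDiffOn_const.clm_comp (hΘ.clm_comp contDiffOn_const)
  have hQ : ContDiffOn ℝ ∞ Q U := contDiffOn_const.clm_comp (hΘ.clm_comp contDiffOn_const)
  have hPQ : ∀ z (v : H × K) (k : K), Θ z v (0, k) = Q z v.1 k + P z v.2 k := by
    intro z v k
    have : v = (v.1, 0) + (0, v.2) := by simp
    conv_lhs => rw [this, map_add]
    rfl
  -- By antisymmetry `(0, k)` already pairs to zero with the kernel `H × 0`. If it also pairs to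
  -- zero with `K`, it lies in the kernel, so `k = 0`.
  have hP0inj : Function.Injective (P 0) := by
    rw [injective_iff_map_eq_zero]
    intro k hk
    refine (hker (0, k)).1 ?_
    ext w
    · have h1 : Θ 0 (w, 0) = 0 := (hker (w, 0)).2 rfl
      simp [halt 0 h0 (0, k) (w, 0), h1]
    · exact congrArg (fun T : K →L[ℝ] ℝ ↦ T w) hk
  have hfin : Module.finrank ℝ K = Module.finrank ℝ (K →L[ℝ] ℝ) := by
    rw [← (LinearMap.toContinuousLinearMap (𝕜 := ℝ) (E := K) (F' := ℝ)).finrank_eq]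
    exact (Subspace.dual_finrank_eq (K := ℝ) (V := K)).symm
  let P₀ : K ≃L[ℝ] (K →L[ℝ] ℝ) :=
    (LinearEquiv.ofInjectiveOfFinrankEq (P 0).toLinearMap hP0inj hfin).toContinuousLinearEquiv
  have hP₀ : (P₀ : K →L[ℝ] (K →L[ℝ] ℝ)) = P 0 := by ext; rfl
  let V := U ∩ P ⁻¹' range ((↑) : (K ≃L[ℝ] (K →L[ℝ] ℝ)) → K →L[ℝ] (K →L[ℝ] ℝ))
  have hV : IsOpen V := hP.continuousOn.isOpen_inter_preimage hU ContinuousLinearEquiv.isOpen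
  have h0V : 0 ∈ V := ⟨h0, P₀, hP₀⟩
  -- A kernel vector `(h, k)` satisfies `Q h + P k = 0`. This gives only the inclusion of the kernel
  -- in the graph; the rank hypothesis upgrades it to equality.
  let A₀ : H × K → H →L[ℝ] K := fun z ↦ -((P z).inverse.comp (Q z))
  have hA₀ : ContDiffOn ℝ ∞ A₀ V := by
    intro z hz
    obtain ⟨T, hT⟩ := hz.2
    have h1 : ContDiffAt ℝ ∞ (fun z ↦ (P z).inverse) z := by
      have := contDiffAt_map_inverse (𝕜 := ℝ) (n := ∞) T
      rw [hT] at this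
      exact this.comp z ((hP z hz.1).contDiffAt (hU.mem_nhds hz.1))
    exact (h1.clm_comp ((hQ z hz.1).contDiffAt (hU.mem_nhds hz.1))).neg.contDiffWithinAt
  obtain ⟨A, hA, hAeq⟩ := exists_contDiff_eventuallyEq hV hA₀ h0V
  refine ⟨A, hA, ?_⟩
  filter_upwards [hAeq, hV.mem_nhds h0V] with z hz hzV
  refine ⟨hzV.1, ?_⟩
  obtain ⟨T, hT⟩ := hzV.2
  have hsub : LinearMap.ker (Θ z).toLinearMap ≤ LinearMap.graph (A z).toLinearMap := by
    intro v hv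
    have hv' : Θ z v = 0 := hv
    have h1 : T v.2 = -Q z v.1 := by
      ext k
      have := hPQ z v k
      rw [hv', ← hT] at this
      simp only [zero_apply, ContinuousLinearEquiv.coe_coe] at this
      simp only [neg_apply]
      linarith
    rw [LinearMap.mem_graph_iff]
    show v.2 = A z v.1
    rw [hz]
    show v.2 = -((P z).inverse (Q z v.1))
    rw [← hT, ContinuousLinearMap.inverse_equiv, ← map_neg]
    exact ((T.symm_apply_eq).2 h1.symm).symm
  have hgr : Module.finrank ℝ (LinearMap.graph (A z).toLinearMap) = Module.finrank ℝ H :=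
    (LinearEquiv.ofBijective ((LinearMap.fst ℝ H K).comp
      (LinearMap.graph (A z).toLinearMap).subtype) ⟨fun a b hab ↦ by
        have ha := (LinearMap.mem_graph_iff _ _).1 a.2
        have hb := (LinearMap.mem_graph_iff _ _).1 b.2
        have hab' : (a : H × K).1 = (b : H × K).1 := hab
        exact Subtype.ext (Prod.ext hab' (by rw [ha, hb, hab'])),
      fun x ↦ ⟨⟨(x, A z x), (LinearMap.mem_graph_iff _ _).2 rfl⟩, rfl⟩⟩).finrank_eq
  have heq := Submodule.eq_of_le_of_finrank_eq hsub ((hrank z hzV.1).trans hgr.symm)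
  intro v
  have := LinearMap.mem_graph_iff (A z).toLinearMap v
  rw [← heq] at this
  exact this

end GraphForm

/-! ### Frobenius theorem for kernels of two-forms -/

section FrobeniusForms

universe u


section Product

variable {H K : Type u} [NormedAddCommGroup H] [NormedSpace ℝ H] [FiniteDimensional ℝ H]
  [NormedAddCommGroup K] [NormedSpace ℝ K] [FiniteDimensional ℝ K]

/-- The graphs of `A` satisfy the integrability condition as soon as they are the kernels of a
two-form whose exterior derivative vanishes on pairs of vectors in the kernel. -/
lemma isSymmetricAt_of_ker_eq_graph {Θ : H × K → (H × K) →L[ℝ] (H × K) →L[ℝ] ℝ}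
    {A : H × K → H →L[ℝ] K} (hA : ContDiff ℝ ∞ A) {z : H × K} (hΘ : DifferentiableAt ℝ Θ z)
    (halt : ∀ᶠ y in 𝓝 z, ∀ a b, Θ y a b = -Θ y b a)
    (hker : ∀ᶠ y in 𝓝 z, ∀ v : H × K, Θ y v = 0 ↔ v.2 = A y v.1)
    (hd : ∀ a b c, Θ z a = 0 → Θ z b = 0 → extDerivBilin Θ z a b c = 0) :
    IsSymmetricAt A z := by
  intro v w
  have hX : ∀ u : H, HasFDerivAt (fun y ↦ (u, A y u))
      ((0 : (H × K) →L[ℝ] H).prod ((ContinuousLinearMap.apply ℝ K u).comp (fderiv ℝ A z))) z := by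
    intro u
    exact (hasFDerivAt_const u z).prodMk ((ContinuousLinearMap.apply ℝ K u).hasFDerivAt.comp z
      (hA.differentiable (by simp) z).hasFDerivAt)
  have hzero : ∀ u : H, ∀ᶠ y in 𝓝 z, Θ y (u, A y u) = 0 := fun u ↦
    hker.mono fun y hy ↦ (hy _).2 rfl
  -- The lifts `(w, A w)` and `(v, A v)` of constant vectors have a vertical bracket. Lying in the
  -- kernel, hence in the graph, it must vanish, and its vertical component is the defect of
  -- symmetry.
  have h1 := apply_lieBracket_eq_zero hΘ halt (hX w).differentiableAt (hX v).differentiableAt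
    (hzero w) (hzero v) (fun c ↦ hd _ _ c (hzero w).self_of_nhds (hzero v).self_of_nhds)
  have h2 := (hker.self_of_nhds _).1 h1
  rw [VectorField.lieBracket, (hX v).fderiv, (hX w).fderiv] at h2
  simp only [ContinuousLinearMap.prod_apply, ContinuousLinearMap.comp_apply, zero_apply,
    ContinuousLinearMap.apply_apply, Prod.mk_sub_mk, sub_self, map_zero] at h2
  exact (sub_eq_zero.1 h2).symm

/-- The kernel of a two-form of constant rank is horizontal in suitable coordinates, if the exterior
derivative of the form vanishes on pairs of vectors in the kernel. -/
lemma exists_flat_coordinates_ker_prod {Θ : H × K → (H × K) →L[ℝ] (H × K) →L[ℝ] ℝ}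
    {U : Set (H × K)} (hU : IsOpen U) (h0 : 0 ∈ U) (hΘ : ContDiffOn ℝ ∞ Θ U)
    (halt : ∀ z ∈ U, ∀ a b, Θ z a b = -Θ z b a)
    (hker : ∀ v : H × K, Θ 0 v = 0 ↔ v.2 = 0)
    (hrank : ∀ z ∈ U, Module.finrank ℝ (LinearMap.ker (Θ z).toLinearMap) = Module.finrank ℝ H)
    (hd : ∀ z ∈ U, ∀ a b c, Θ z a = 0 → Θ z b = 0 → extDerivBilin Θ z a b c = 0) :
    ∃ e : OpenPartialHomeomorph (H × K) (H × K), 0 ∈ e.source ∧ e.source ⊆ U ∧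
      ContDiffOn ℝ ∞ e e.source ∧ ContDiffOn ℝ ∞ e.symm e.target ∧
      ∀ z ∈ e.source, ∀ v, Θ z v = 0 ↔ (fderiv ℝ e z v).2 = 0 := by
  obtain ⟨A, hA, hgraph⟩ := exists_ker_eq_graph hU h0 hΘ halt hker hrank
  obtain ⟨O, hOsub, hO, h0O⟩ := eventually_nhds_iff.1 hgraph
  have hsymm : ∀ p ∈ O, IsSymmetricAt A p := fun p hp ↦ by
    have hpU := (hOsub p hp).1
    exact isSymmetricAt_of_ker_eq_graph hA
      (((hΘ p hpU).contDiffAt (hU.mem_nhds hpU)).differentiableAt (by simp))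
      (Filter.eventually_of_mem (hU.mem_nhds hpU) halt)
      (Filter.eventually_of_mem (hO.mem_nhds hp) fun y hy ↦ (hOsub y hy).2) (hd p hpU)
  obtain ⟨e, h0e, hsm, hsm', he⟩ :=
    exists_flat_coordinates_graph (y₀ := (0 : K)) hA (hO.mem_nhds h0O) hsymm
  refine ⟨e.restrOpen O hO, ⟨h0e, h0O⟩, fun z hz ↦ (hOsub z hz.2).1,
    hsm.mono fun z hz ↦ hz.1, hsm'.mono ?_, fun z hz v ↦ ?_⟩
  · intro y hy
    exact hy.1
  · exact ((hOsub z hz.2).2 v).trans (he z hz.1 v)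

end Product

variable {F : Type u} [NormedAddCommGroup F] [NormedSpace ℝ F] [FiniteDimensional ℝ F]

lemma exists_hasFDerivAt_apply_apply {G A B C : Type*} [NormedAddCommGroup G] [NormedSpace ℝ G]
    [NormedAddCommGroup A] [NormedSpace ℝ A] [NormedAddCommGroup B] [NormedSpace ℝ B]
    [NormedAddCommGroup C] [NormedSpace ℝ C] {Ξ : G → A →L[ℝ] B →L[ℝ] C} {X : G → A} {Y : G → B}
    {Ξ' : G →L[ℝ] A →L[ℝ] B →L[ℝ] C} {X' : G →L[ℝ] A} {Y' : G →L[ℝ] B} {w : G}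
    (hΞ : HasFDerivAt Ξ Ξ' w) (hX : HasFDerivAt X X' w) (hY : HasFDerivAt Y Y' w) :
    ∃ D : G →L[ℝ] C, HasFDerivAt (fun y ↦ Ξ y (X y) (Y y)) D w ∧
      ∀ a, D a = Ξ' a (X w) (Y w) + Ξ w (X' a) (Y w) + Ξ w (X w) (Y' a) := by
  refine ⟨_, (hΞ.clm_apply hX).clm_apply hY, fun a ↦ ?_⟩
  simp
  abel

lemma differentiableAt_bilinearComp {G A B : Type*} [NormedAddCommGroup G] [NormedSpace ℝ G]
    [NormedAddCommGroup A] [NormedSpace ℝ A] [NormedAddCommGroup B] [NormedSpace ℝ B]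
    {Ξ : G → A →L[ℝ] A →L[ℝ] ℝ} {L : G → B →L[ℝ] A} {w : G}
    (hΞ : DifferentiableAt ℝ Ξ w) (hL : DifferentiableAt ℝ L w) :
    DifferentiableAt ℝ (fun y ↦ (Ξ y).bilinearComp (L y) (L y)) w := by
  have h1 : DifferentiableAt ℝ (fun y ↦ (ContinuousLinearMap.compL ℝ B A ℝ).flip (L y)) w :=
    (ContinuousLinearMap.compL ℝ B A ℝ).flip.differentiableAt.comp w hL
  exact h1.clm_comp (hΞ.clm_comp hL)

lemma fderiv_pullback_apply {G : Type*} [NormedAddCommGroup G] [NormedSpace ℝ G]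
    {V : Type*} [NormedAddCommGroup V] [NormedSpace ℝ V] {Θ : V → F →L[ℝ] F →L[ℝ] ℝ}
    {f : G → V} {L : G → G →L[ℝ] F} {f' : G →L[ℝ] V} {w : G}
    (hf : HasFDerivAt f f' w) (hL : DifferentiableAt ℝ L w)
    (hΘ : DifferentiableAt ℝ Θ (f w)) (a b c : G) :
    fderiv ℝ (fun w ↦ (Θ (f w)).bilinearComp (L w) (L w)) w a b c =
      fderiv ℝ Θ (f w) (f' a) (L w b) (L w c) + Θ (f w) (fderiv ℝ L w a b) (L w c) +
        Θ (f w) (L w b) (fderiv ℝ L w a c) := by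
  have hcomp : HasFDerivAt (fun w ↦ Θ (f w)) ((fderiv ℝ Θ (f w)).comp f') w :=
    hΘ.hasFDerivAt.comp w hf
  have hdiff := differentiableAt_bilinearComp hcomp.differentiableAt hL
  have hLv : ∀ v : G, HasFDerivAt (fun w ↦ L w v) ((fderiv ℝ L w).flip v) w := fun v ↦ by
    simpa using hL.hasFDerivAt.clm_apply (hasFDerivAt_const v w)
  obtain ⟨D₁, hD₁, hD₁'⟩ := exists_hasFDerivAt_apply_apply hdiff.hasFDerivAt
    (hasFDerivAt_const b w) (hasFDerivAt_const c w)
  obtain ⟨D₂, hD₂, hD₂'⟩ := exists_hasFDerivAt_apply_apply hcomp (hLv b) (hLv c)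
  have h3 : D₁ a = D₂ a := congrArg (fun S : G →L[ℝ] ℝ ↦ S a) (hD₁.unique hD₂)
  simpa [hD₁', hD₂'] using h3

/-- The exterior derivative commutes with pull-backs. -/
lemma extDerivBilin_pullback {G : Type*} [NormedAddCommGroup G] [NormedSpace ℝ G]
    {Θ : F → F →L[ℝ] F →L[ℝ] ℝ} {f : G → F} {f' : G → G →L[ℝ] F} {w : G}
    (hf : ∀ᶠ y in 𝓝 w, HasFDerivAt f (f' y) y) (hf' : DifferentiableAt ℝ f' w)
    (hΘ : DifferentiableAt ℝ Θ (f w)) (halt : ∀ a b, Θ (f w) a b = -Θ (f w) b a) (a b c : G) :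
    extDerivBilin (fun w ↦ (Θ (f w)).bilinearComp (f' w) (f' w)) w a b c =
      extDerivBilin Θ (f w) (f' w a) (f' w b) (f' w c) := by
  have hsymm := fun u v ↦ second_derivative_symmetric_of_eventually hf hf'.hasFDerivAt u v
  simp only [extDerivBilin, fderiv_pullback_apply hf.self_of_nhds hf' hΘ]
  -- The remaining terms contain second derivatives of `f`; they are symmetric in their arguments
  -- and cancel in pairs against the antisymmetric `Θ`.
  have h1 := halt (f' w b) (fderiv ℝ f' w a c)
  have h2 := halt (f' w c) (fderiv ℝ f' w b a)
  have h3 := halt (f' w a) (fderiv ℝ f' w c b)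
  rw [hsymm c a, hsymm b c, hsymm b a] at *
  linarith

/-- **Frobenius theorem** for the kernel of a two-form of constant rank whose exterior derivative
vanishes on pairs of vectors in the kernel: there are smooth coordinates in which the kernel is a
given subspace. -/
theorem exists_flat_coordinates_ker {Θ : F → F →L[ℝ] F →L[ℝ] ℝ} {U : Set F} (hU : IsOpen U)
    {z₀ : F} (hz₀ : z₀ ∈ U) (hΘ : ContDiffOn ℝ ∞ Θ U)
    (halt : ∀ z ∈ U, ∀ a b, Θ z a b = -Θ z b a) (S : Submodule ℝ F)
    (hrank : ∀ z ∈ U, Module.finrank ℝ (LinearMap.ker (Θ z).toLinearMap) = Module.finrank ℝ S)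
    (hd : ∀ z ∈ U, ∀ a b c, Θ z a = 0 → Θ z b = 0 → extDerivBilin Θ z a b c = 0) :
    ∃ e : OpenPartialHomeomorph F F, z₀ ∈ e.source ∧ e.source ⊆ U ∧
      ContDiffOn ℝ ∞ e e.source ∧ ContDiffOn ℝ ∞ e.symm e.target ∧
      ∀ z ∈ e.source, ∀ v, Θ z v = 0 ↔ fderiv ℝ e z v ∈ S := by
  obtain ⟨S', hS'⟩ := S.exists_isCompl
  set N := LinearMap.ker (Θ z₀).toLinearMap with hN
  obtain ⟨N', hN'⟩ := N.exists_isCompl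
  have hNS : Module.finrank ℝ S = Module.finrank ℝ N := (hrank z₀ hz₀).symm
  have hNS' : Module.finrank ℝ S' = Module.finrank ℝ N' := by
    have h1 := Submodule.finrank_add_eq_of_isCompl hS'
    have h2 := Submodule.finrank_add_eq_of_isCompl hN'
    omega
  -- Two linear identifications of the model are used: `T` takes the first factor to the kernel at
  -- `z₀` and straightens the source, while `q` takes it to `S` and places the result in the target.
  let q : (S × S') ≃L[ℝ] F := (Submodule.prodEquivOfIsCompl S S' hS').toContinuousLinearEquiv
  let T : (S × S') ≃L[ℝ] F := (((LinearEquiv.ofFinrankEq S N hNS).prodCongr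
    (LinearEquiv.ofFinrankEq S' N' hNS')).trans
      (Submodule.prodEquivOfIsCompl N N' hN')).toContinuousLinearEquiv
  have hq : ∀ v, q v ∈ S ↔ v.2 = 0 := by
    rintro ⟨s, s'⟩
    show (s : F) + s' ∈ S ↔ s' = 0
    rw [S.add_mem_iff_right s.2]
    constructor
    · intro h
      exact Subtype.ext (Submodule.disjoint_def.1 hS'.disjoint _ h s'.2)
    · rintro rfl
      simp
  have hT : ∀ v, Θ z₀ (T v) = 0 ↔ v.2 = 0 := by
    rintro ⟨s, s'⟩
    show ((LinearEquiv.ofFinrankEq S N hNS s : N) : F) +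
      ((LinearEquiv.ofFinrankEq S' N' hNS' s' : N') : F) ∈ N ↔ s' = 0
    rw [N.add_mem_iff_right (LinearEquiv.ofFinrankEq S N hNS s).2]
    constructor
    · intro h
      have : LinearEquiv.ofFinrankEq S' N' hNS' s' = 0 := Subtype.ext
        (Submodule.disjoint_def.1 hN'.disjoint _ h (LinearEquiv.ofFinrankEq S' N' hNS' s').2)
      exact (LinearEquiv.map_eq_zero_iff _).1 this
    · rintro rfl
      simp
  let Θ' : S × S' → (S × S') →L[ℝ] (S × S') →L[ℝ] ℝ := fun w ↦
    (Θ (z₀ + T w)).bilinearComp (T : (S × S') →L[ℝ] F) (T : (S × S') →L[ℝ] F)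
  let τ : (S × S') ≃ₜ F := T.toHomeomorph.trans (Homeomorph.addLeft z₀)
  have hτ : ∀ w, τ w = z₀ + T w := fun w ↦ rfl
  have hτ' : ContDiff ℝ ∞ fun w ↦ z₀ + T w := contDiff_const.add T.contDiff
  have hΘker : ∀ w v, Θ' w v = 0 ↔ Θ (z₀ + T w) (T v) = 0 := by
    intro w v
    constructor
    · intro h
      ext x
      have := congrArg (fun R : (S × S') →L[ℝ] ℝ ↦ R (T.symm x)) h
      simpa [Θ'] using this
    · intro h
      ext x <;> simp [Θ', h]
  let U' := (fun w ↦ z₀ + T w) ⁻¹' U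
  have hU' : IsOpen U' := hU.preimage hτ'.continuous
  obtain ⟨e, h0e, heU, hsm, hsm', he⟩ := exists_flat_coordinates_ker_prod (Θ := Θ') (U := U') hU'
    (by simpa [U'] using hz₀)
    (by
      have h1 : ContDiffOn ℝ ∞ (fun w ↦ Θ (z₀ + T w)) U' :=
        hΘ.comp hτ'.contDiffOn (fun w hw ↦ hw)
      have h2 : ContDiffOn ℝ ∞ (fun w ↦ (((ContinuousLinearMap.compL ℝ (S × S') F ℝ).flip
          (T : (S × S') →L[ℝ] F)).comp (Θ (z₀ + T w))).comp (T : (S × S') →L[ℝ] F)) U' :=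
        (contDiffOn_const.clm_comp h1).clm_comp contDiffOn_const
      exact h2)
    (fun z hz a b ↦ halt _ hz _ _)
    (fun v ↦ by rw [hΘker]; simpa using hT v)
    (fun w hw ↦ by
      have : Submodule.map (T.toLinearEquiv : (S × S') →ₗ[ℝ] F)
          (LinearMap.ker (Θ' w).toLinearMap) = LinearMap.ker (Θ (z₀ + T w)).toLinearMap := by
        ext x
        rw [Submodule.mem_map]
        constructor
        · rintro ⟨y, hy, rfl⟩
          exact (hΘker w y).1 hy
        · intro hx
          exact ⟨T.symm x, (hΘker w _).2 (by simpa using hx), by simp⟩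
      rw [← hrank _ hw, ← this]
      exact (T.toLinearEquiv.submoduleMap _).finrank_eq)
    (fun w hw a b c ha hb ↦ by
      rw [extDerivBilin_pullback (f := fun w ↦ z₀ + T w) (f' := fun _ ↦ (T : (S × S') →L[ℝ] F))
        (Filter.Eventually.of_forall fun w ↦ T.hasFDerivAt.const_add z₀) (differentiableAt_const _)
        (((hΘ _ hw).contDiffAt (hU.mem_nhds hw)).differentiableAt (by simp)) (halt _ hw)]
      exact hd _ hw _ _ _ ((hΘker w a).1 ha) ((hΘker w b).1 hb))
  let e' := (τ.symm.toOpenPartialHomeomorph.trans e).trans q.toHomeomorph.toOpenPartialHomeomorph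
  have hsrc : ∀ z, z ∈ e'.source ↔ τ.symm z ∈ e.source := by
    intro z
    simp [e']
  have htgt : ∀ y, y ∈ e'.target ↔ q.symm y ∈ e.target := by
    intro y
    simp [e']
  have hτs : ∀ z, τ.symm z = T.symm (z - z₀) := by
    intro z
    rw [τ.symm_apply_eq, hτ]
    simp
  have hcoe : (e' : F → F) = fun z ↦ q (e (T.symm (z - z₀))) := by
    ext z
    show q (e (τ.symm z)) = _
    rw [hτs]
  refine ⟨e', ?_, ?_, ?_, ?_, ?_⟩
  · rw [hsrc, hτs]
    simpa using h0e
  · intro z hz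
    have := heU ((hsrc z).1 hz)
    rw [hτs] at this
    simpa [U'] using this
  · rw [hcoe]
    refine q.contDiff.comp_contDiffOn (hsm.comp
      (T.symm.contDiff.comp (contDiff_id.sub contDiff_const)).contDiffOn ?_)
    intro z hz
    have := (hsrc z).1 hz
    rwa [hτs] at this
  · have : (e'.symm : F → F) = fun y ↦ z₀ + T (e.symm (q.symm y)) := rfl
    rw [this]
    exact hτ'.comp_contDiffOn (hsm'.comp q.symm.contDiff.contDiffOn fun y hy ↦ (htgt y).1 hy)
  · intro z hz v
    have hz' := (hsrc z).1 hz
    rw [hτs] at hz'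
    have h1 : HasFDerivAt (fun z ↦ T.symm (z - z₀)) (T.symm : F →L[ℝ] S × S') z :=
      T.symm.hasFDerivAt.comp z ((hasFDerivAt_id z).sub_const z₀)
    have h2 : HasFDerivAt e (fderiv ℝ e (T.symm (z - z₀))) (T.symm (z - z₀)) :=
      (((hsm _ hz').contDiffAt (e.open_source.mem_nhds hz')).differentiableAt
        (by simp)).hasFDerivAt
    have h3 : HasFDerivAt (fun z ↦ q (e (T.symm (z - z₀)))) _ z :=
      q.hasFDerivAt.comp z (h2.comp z h1)
    rw [hcoe, h3.fderiv]
    have h4 := (he _ hz' (T.symm v)).symm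
    rw [hΘker] at h4
    simp only [ContinuousLinearEquiv.apply_symm_apply, add_sub_cancel] at h4
    exact h4.symm.trans (hq _).symm

end FrobeniusForms

/-! ### Coordinate vector fields -/

section Charts

variable {d : ℕ} {M : Type*} [TopologicalSpace M] [ChartedSpace (EuclideanSpace ℝ (Fin d)) M]
  [IsManifold (𝓡 d) ∞ M] {c : OpenPartialHomeomorph M (EuclideanSpace ℝ (Fin d))}

lemma two_le_infty : (2 : WithTop ℕ∞) ≤ ∞ :=
  WithTop.coe_le_coe.2 (le_top : (2 : ℕ∞) ≤ ⊤)

lemma minSmoothness_two_le_infty : minSmoothness ℝ 2 ≤ ∞ := by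
  rw [minSmoothness_of_isRCLikeNormedField]
  exact two_le_infty

instance isManifold_minSmoothness : IsManifold (𝓡 d) (minSmoothness ℝ 2) M :=
  .of_le minSmoothness_two_le_infty

lemma mdifferentiable_of_mem_maximalAtlas (hc : c ∈ IsManifold.maximalAtlas (𝓡 d) ∞ M) :
    c.MDifferentiable (𝓡 d) (𝓡 d) :=
  ⟨(contMDiffOn_of_mem_maximalAtlas hc).mdifferentiableOn (by simp),
    (contMDiffOn_symm_of_mem_maximalAtlas hc).mdifferentiableOn (by simp)⟩

lemma isInvertible_mfderiv_chart (hc : c ∈ IsManifold.maximalAtlas (𝓡 d) ∞ M) {x : M}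
    (hx : x ∈ c.source) : (mfderiv (𝓡 d) (𝓡 d) c x).IsInvertible :=
  ⟨(mdifferentiable_of_mem_maximalAtlas hc).mfderiv hx, rfl⟩

lemma isInvertible_mfderiv_chart_symm (hc : c ∈ IsManifold.maximalAtlas (𝓡 d) ∞ M)
    {w : EuclideanSpace ℝ (Fin d)} (hw : w ∈ c.target) :
    (mfderiv (𝓡 d) (𝓡 d) c.symm w).IsInvertible :=
  ⟨(mdifferentiable_of_mem_maximalAtlas hc).symm.mfderiv hw, rfl⟩

/-- The constant vector field on the model space. -/
def constField (a : EuclideanSpace ℝ (Fin d)) :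
    ∀ x : EuclideanSpace ℝ (Fin d), TangentSpace (𝓡 d) x := fun _ ↦ a

lemma contMDiffAt_constField (a x : EuclideanSpace ℝ (Fin d)) :
    ContMDiffAt (𝓡 d) (𝓡 d).tangent ∞ (fun y ↦ (⟨y, constField a y⟩ :
      TangentBundle (𝓡 d) (EuclideanSpace ℝ (Fin d)))) x :=
  contMDiffAt_vectorSpace_iff_contDiffAt.2 contDiffAt_const

/-- The vector field with constant components `a` in the chart `c`. -/
def coordField (c : OpenPartialHomeomorph M (EuclideanSpace ℝ (Fin d)))
    (a : EuclideanSpace ℝ (Fin d)) : ∀ x : M, TangentSpace (𝓡 d) x :=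
  VectorField.mpullback (𝓡 d) (𝓡 d) c (constField a)

/-- The derivative of the inverse of the chart `c`. -/
def chartSymmDeriv (c : OpenPartialHomeomorph M (EuclideanSpace ℝ (Fin d)))
    (w : EuclideanSpace ℝ (Fin d)) : EuclideanSpace ℝ (Fin d) →L[ℝ] EuclideanSpace ℝ (Fin d) :=
  mfderiv (𝓡 d) (𝓡 d) c.symm w

lemma coordField_symm (hc : c ∈ IsManifold.maximalAtlas (𝓡 d) ∞ M)
    {w : EuclideanSpace ℝ (Fin d)} (hw : w ∈ c.target) (a : EuclideanSpace ℝ (Fin d)) :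
    coordField c a (c.symm w) = chartSymmDeriv c w a := by
  have h1 := (mdifferentiable_of_mem_maximalAtlas hc).comp_symm_deriv hw
  have h2 := isInvertible_mfderiv_chart hc (c.map_target hw)
  have h3 := congrArg (fun T ↦ T a) h1
  exact h2.inverse_apply_eq.2 h3.symm

lemma contMDiffAt_coordField (hc : c ∈ IsManifold.maximalAtlas (𝓡 d) ∞ M) {x : M}
    (hx : x ∈ c.source) (a : EuclideanSpace ℝ (Fin d)) :
    ContMDiffAt (𝓡 d) (𝓡 d).tangent ∞
      (fun y : M ↦ (⟨y, coordField c a y⟩ : TangentBundle (𝓡 d) M)) x :=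
  ContMDiffAt.mpullback_vectorField_preimage (n := ∞) (contMDiffAt_constField a _)
    (contMDiffAt_of_mem_maximalAtlas hc hx) (isInvertible_mfderiv_chart hc hx) (by simp)

/-- Constant fields commute and brackets are natural under pullback. With vanishing torsion this
makes covariant derivatives of coordinate fields symmetric. -/
lemma mlieBracket_coordField (hc : c ∈ IsManifold.maximalAtlas (𝓡 d) ∞ M) {x : M}
    (hx : x ∈ c.source) (a b : EuclideanSpace ℝ (Fin d)) :
    VectorField.mlieBracket (𝓡 d) (coordField c a) (coordField c b) x = 0 := by
  have hconst : ∀ a : EuclideanSpace ℝ (Fin d), MDifferentiableAt (𝓡 d) (𝓡 d).tangent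
      (fun y ↦ (⟨y, constField a y⟩ : TangentBundle (𝓡 d) (EuclideanSpace ℝ (Fin d)))) (c x) :=
    fun a ↦ (contMDiffAt_constField a _).mdifferentiableAt (by simp)
  have h := VectorField.mpullback_mlieBracket (n := ∞) (hconst a) (hconst b)
    (contMDiffAt_of_mem_maximalAtlas hc hx) minSmoothness_two_le_infty
  have h0 : VectorField.mlieBracket (𝓡 d) (constField a) (constField b) (c x) = 0 := by
    rw [← VectorField.mlieBracketWithin_univ, VectorField.mlieBracketWithin_eq_lieBracketWithin]
    show fderivWithin ℝ (fun _ ↦ b) univ (c x) a - fderivWithin ℝ (fun _ ↦ a) univ (c x) b = 0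
    simp
  rw [coordField, coordField, ← h, VectorField.mpullback_apply, h0, map_zero]

end Charts

/-! ### The fundamental two-form in coordinates -/

section FundamentalForm

variable {d : ℕ} {M : Type*} [TopologicalSpace M] [ChartedSpace (EuclideanSpace ℝ (Fin d)) M]
  [IsManifold (𝓡 d) ∞ M] {c : OpenPartialHomeomorph M (EuclideanSpace ℝ (Fin d))}

/-- The metric at `x`, as a bilinear form on the model space. -/
def SemiRiemannianMetric.formAt (g : SemiRiemannianMetric d M) (x : M) :
    EuclideanSpace ℝ (Fin d) →L[ℝ] EuclideanSpace ℝ (Fin d) →L[ℝ] ℝ := g.toFun x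

/-- The endomorphism at `x`, as an endomorphism of the model space. -/
def EndField.endAt (J : EndField d M) (x : M) :
    EuclideanSpace ℝ (Fin d) →L[ℝ] EuclideanSpace ℝ (Fin d) := J x

/-- The coordinate expression of the two-form `g (J ·, ·)` in the chart `c`. -/
def coordForm (g : SemiRiemannianMetric d M) (J : EndField d M)
    (c : OpenPartialHomeomorph M (EuclideanSpace ℝ (Fin d))) (w : EuclideanSpace ℝ (Fin d)) :
    EuclideanSpace ℝ (Fin d) →L[ℝ] EuclideanSpace ℝ (Fin d) →L[ℝ] ℝ :=
  ((g.formAt (c.symm w)).comp (EndField.endAt J (c.symm w))).bilinearComp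
    (chartSymmDeriv c w) (chartSymmDeriv c w)

lemma coordForm_apply (g : SemiRiemannianMetric d M) (J : EndField d M)
    (hc : c ∈ IsManifold.maximalAtlas (𝓡 d) ∞ M)
    {w : EuclideanSpace ℝ (Fin d)} (hw : w ∈ c.target) (a b : EuclideanSpace ℝ (Fin d)) :
    coordForm g J c w a b = g.toFun (c.symm w)
      (J (c.symm w) (coordField c a (c.symm w))) (coordField c b (c.symm w)) := by
  rw [coordField_symm hc hw, coordField_symm hc hw]
  rfl

variable {g : SemiRiemannianMetric d M} {J : EndField d M} {U : Set M}

lemma contMDiffAt_end_coordField (hc : c ∈ IsManifold.maximalAtlas (𝓡 d) ∞ M)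
    (hU : IsOpen U) (hJ : SmoothEndOn J U) {x : M} (hx : x ∈ c.source) (hxU : x ∈ U)
    (a : EuclideanSpace ℝ (Fin d)) :
    ContMDiffAt (𝓡 d) (𝓡 d).tangent ∞
      (fun y : M ↦ (⟨y, J y (coordField c a y)⟩ : TangentBundle (𝓡 d) M)) x :=
  ContMDiffAt.clm_bundle_apply (b := fun y ↦ y) (hJ.contMDiffAt (hU.mem_nhds hxU))
    (contMDiffAt_coordField hc hx a)

lemma contMDiffAt_metric_apply {X Y : ∀ x : M, TangentSpace (𝓡 d) x} {x : M}
    (hX : ContMDiffAt (𝓡 d) (𝓡 d).tangent ∞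
      (fun y : M ↦ (⟨y, X y⟩ : TangentBundle (𝓡 d) M)) x)
    (hY : ContMDiffAt (𝓡 d) (𝓡 d).tangent ∞
      (fun y : M ↦ (⟨y, Y y⟩ : TangentBundle (𝓡 d) M)) x) :
    ContMDiffAt (𝓡 d) 𝓘(ℝ, ℝ) ∞ (fun y ↦ g.toFun y (X y) (Y y)) x := by
  have h := ContMDiffAt.clm_bundle_apply₂ (b := fun y : M ↦ y) (E₃ := fun _ : M ↦ ℝ) (F₃ := ℝ)
    (g.contMDiff x) hX hY
  exact (contMDiffAt_section _).1 h |>.congr_of_eventuallyEq (by rfl)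

lemma contMDiffAt_form_coordField (hc : c ∈ IsManifold.maximalAtlas (𝓡 d) ∞ M)
    (hU : IsOpen U) (hJ : SmoothEndOn J U) {x : M} (hx : x ∈ c.source) (hxU : x ∈ U)
    (a b : EuclideanSpace ℝ (Fin d)) :
    ContMDiffAt (𝓡 d) 𝓘(ℝ, ℝ) ∞
      (fun y ↦ g.toFun y (J y (coordField c a y)) (coordField c b y)) x :=
  contMDiffAt_metric_apply (contMDiffAt_end_coordField hc hU hJ hx hxU a)
    (contMDiffAt_coordField hc hx b)

lemma isOpen_target_inter_preimage (c : OpenPartialHomeomorph M (EuclideanSpace ℝ (Fin d)))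
    (hU : IsOpen U) : IsOpen (c.target ∩ c.symm ⁻¹' U) :=
  c.symm.isOpen_inter_preimage hU

lemma contDiffOn_coordForm (hc : c ∈ IsManifold.maximalAtlas (𝓡 d) ∞ M)
    (hU : IsOpen U) (hJ : SmoothEndOn J U) :
    ContDiffOn ℝ ∞ (coordForm g J c) (c.target ∩ c.symm ⁻¹' U) := by
  refine contDiffOn_clm_apply.2 fun a ↦ contDiffOn_clm_apply.2 fun b ↦ ?_
  intro w hw
  have h1 := (contMDiffAt_form_coordField (g := g) hc hU hJ (c.map_target hw.1) hw.2 a b).comp w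
    (contMDiffAt_symm_of_mem_maximalAtlas hc hw.1)
  refine (contMDiffAt_iff_contDiffAt.1 h1).contDiffWithinAt.congr (fun y hy ↦ ?_) ?_
  · exact coordForm_apply g J hc hy.1 a b
  · exact coordForm_apply g J hc hw.1 a b

/-- Moves the derivative of the coefficients back to `M`, where compatibility of the connection with
the metric applies. -/
lemma fderiv_coordForm_apply (hc : c ∈ IsManifold.maximalAtlas (𝓡 d) ∞ M)
    (hU : IsOpen U) (hJ : SmoothEndOn J U) {w : EuclideanSpace ℝ (Fin d)}
    (hw : w ∈ c.target) (hwU : c.symm w ∈ U) (a b e : EuclideanSpace ℝ (Fin d)) :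
    fderiv ℝ (coordForm g J c) w a b e =
      mvfderiv (𝓡 d) (fun y ↦ g.toFun y (J y (coordField c b y)) (coordField c e y)) (c.symm w)
        (coordField c a (c.symm w)) := by
  have hO := isOpen_target_inter_preimage c hU
  have h1 : DifferentiableAt ℝ (coordForm g J c) w :=
    ((contDiffOn_coordForm hc hU hJ).contDiffAt (hO.mem_nhds ⟨hw, hwU⟩)).differentiableAt (by simp)
  obtain ⟨D, hD, hDa⟩ := exists_hasFDerivAt_apply_apply h1.hasFDerivAt
    (hasFDerivAt_const b w) (hasFDerivAt_const e w)
  have h2 := (contMDiffAt_form_coordField (g := g) hc hU hJ (c.map_target hw) hwU b e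
    ).mdifferentiableAt (by simp)
  have h3 := (contMDiffAt_symm_of_mem_maximalAtlas hc hw).mdifferentiableAt (by simp)
  have h4 : fderiv ℝ (fun y ↦ coordForm g J c y b e) w = _ := hD.fderiv
  have h5 : (fun y ↦ coordForm g J c y b e) =ᶠ[𝓝 w]
      (fun y ↦ g.toFun y (J y (coordField c b y)) (coordField c e y)) ∘ c.symm :=
    Filter.eventuallyEq_of_mem (hO.mem_nhds ⟨hw, hwU⟩)
      fun y hy ↦ coordForm_apply g J hc hy.1 b e
  have h6 := mfderiv_comp w h2 h3
  rw [mfderiv_eq_fderiv, ← h5.fderiv_eq, h4] at h6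
  have h7 := hDa a
  simp only [zero_apply, map_zero, add_zero] at h7
  rw [← h7, coordField_symm hc hw]
  exact congrArg (fun T ↦ T a) h6

end FundamentalForm

/-! ### Skewness of the structure bundle and the derivative of the fundamental form -/

section Kahler

variable {d : ℕ} {M : Type*} [TopologicalSpace M] [ChartedSpace (EuclideanSpace ℝ (Fin d)) M]
  [IsManifold (𝓡 d) ∞ M] {σ : AlmostParaquaternionicStructure d M} {g : SemiRiemannianMetric d M}
  {U : Set M} {J : Fin 3 → EndField d M}

lemma eps_ne_zero (α : Fin 3) : eps α ≠ 0 := by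
  fin_cases α <;> simp [eps]

lemma IsCanonicalLocalBasis.apply_apply (hJ : IsCanonicalLocalBasis σ.toFun U J) {x : M}
    (hx : x ∈ U) (α : Fin 3) (v : TangentSpace (𝓡 d) x) :
    J α x (J α x v) = -(eps α) • v :=
  congrArg (fun T ↦ T v) (hJ.sq x hx α)

lemma IsCanonicalLocalBasis.mem (hJ : IsCanonicalLocalBasis σ.toFun U J) {x : M}
    (hx : x ∈ U) (α : Fin 3) : J α x ∈ σ.toFun x := by
  rw [← hJ.span_eq x hx]
  exact Submodule.subset_span ⟨α, rfl⟩

/-- Put `J w` for the second vector in adaptedness, use `J² = -ε`, and cancel the nonzero sign. -/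
lemma IsAdapted.skew_basis (hg : IsAdapted σ g) (hJ : IsCanonicalLocalBasis σ.toFun U J) {x : M}
    (hx : x ∈ U) (α : Fin 3) (v w : TangentSpace (𝓡 d) x) :
    g.toFun x (J α x v) w = -g.toFun x v (J α x w) := by
  have h := hg U J hJ x hx α v (J α x w)
  rw [hJ.apply_apply hx, map_smul, smul_eq_mul] at h
  refine mul_left_cancel₀ (eps_ne_zero α) ?_
  linarith

lemma IsAdapted.skew (hg : IsAdapted σ g) {x : M}
    {B : TangentSpace (𝓡 d) x →L[ℝ] TangentSpace (𝓡 d) x} (hB : B ∈ σ.toFun x)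
    (v w : TangentSpace (𝓡 d) x) : g.toFun x (B v) w = -g.toFun x v (B w) := by
  obtain ⟨U, J, hx, hJ⟩ := σ.exists_basis x
  rw [← hJ.span_eq x hx] at hB
  induction hB using Submodule.span_induction with
  | mem B h =>
    obtain ⟨α, rfl⟩ := h
    exact hg.skew_basis hJ hx α v w
  | zero => simp
  | add B C _ _ hB hC =>
    simp only [add_apply, map_add, hB, hC]
    ring
  | smul a B _ hB =>
    simp only [smul_apply, map_smul, hB, smul_neg]

lemma IsAdapted.swap (hg : IsAdapted σ g) {x : M}
    {B : TangentSpace (𝓡 d) x →L[ℝ] TangentSpace (𝓡 d) x} (hB : B ∈ σ.toFun x)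
    (v w : TangentSpace (𝓡 d) x) : g.toFun x (B v) w = -g.toFun x (B w) v := by
  rw [hg.skew hB, g.symm]

variable {c : OpenPartialHomeomorph M (EuclideanSpace ℝ (Fin d))}

lemma coordForm_swap (hg : IsAdapted σ g) (hJ : IsCanonicalLocalBasis σ.toFun U J) (α : Fin 3)
    (hc : c ∈ IsManifold.maximalAtlas (𝓡 d) ∞ M) {w : EuclideanSpace ℝ (Fin d)}
    (hw : w ∈ c.target) (hwU : c.symm w ∈ U) (a b : EuclideanSpace ℝ (Fin d)) :
    coordForm g (J α) c w a b = -coordForm g (J α) c w b a := by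
  rw [coordForm_apply g (J α) hc hw, coordForm_apply g (J α) hc hw]
  exact hg.swap (hJ.mem hwU α) _ _

/-- The exterior derivative of the fundamental form `g (J ·, ·)` of a member `J` of a canonical
local basis is expressed through members of the structure bundle. -/
lemma exists_extDerivBilin_coordForm (hK : IsParaquaternionicKahler σ g)
    (hJ : IsCanonicalLocalBasis σ.toFun U J) (α : Fin 3)
    (hc : c ∈ IsManifold.maximalAtlas (𝓡 d) ∞ M) {w : EuclideanSpace ℝ (Fin d)}
    (hw : w ∈ c.target) (hwU : c.symm w ∈ U) :
    ∃ S : EuclideanSpace ℝ (Fin d) →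
        (TangentSpace (𝓡 d) (c.symm w) →L[ℝ] TangentSpace (𝓡 d) (c.symm w)),
      (∀ a, S a ∈ σ.toFun (c.symm w)) ∧ ∀ a b e, extDerivBilin (coordForm g (J α) c) w a b e =
        g.toFun (c.symm w) (S a (coordField c b (c.symm w))) (coordField c e (c.symm w)) +
        g.toFun (c.symm w) (S b (coordField c e (c.symm w))) (coordField c a (c.symm w)) +
        g.toFun (c.symm w) (S e (coordField c a (c.symm w))) (coordField c b (c.symm w)) := by
  obtain ⟨cov, hLC, hpar⟩ := hK.parallel
  set x := c.symm w with hxdef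
  have hx : x ∈ c.source := c.map_target hw
  have hA : ∀ a, VFDiffAt (coordField c a) x :=
    fun a ↦ (contMDiffAt_coordField hc hx a).mdifferentiableAt (by simp)
  have hJA : ∀ a, VFDiffAt (fun y ↦ J α y (coordField c a y)) x := fun a ↦
    (contMDiffAt_end_coordField hc hJ.isOpen (hJ.smooth α) hx hwU a).mdifferentiableAt (by simp)
  -- `S a` is the covariant derivative of `J α` in the direction of the coordinate field of `a`.
  choose S hS hSY using fun a ↦ hpar U (J α) hJ.isOpen (hJ.smooth α)
    (fun y hy ↦ hJ.mem hy α) x hwU (coordField c a x)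
  have hsymm : ∀ a b, cov (coordField c b) x (coordField c a x) =
      cov (coordField c a) x (coordField c b x) := fun a b ↦ by
    have h := (CovariantDerivative.torsion_eq_zero_iff cov).1 hLC.torsion_eq_zero
      (hA a) (hA b)
    rw [mlieBracket_coordField hc hx] at h
    exact sub_eq_zero.1 h
  have hD : ∀ a b e, fderiv ℝ (coordForm g (J α) c) w a b e =
      g.toFun x (S a (coordField c b x)) (coordField c e x) -
      g.toFun x (J α x (coordField c e x)) (cov (coordField c b) x (coordField c a x)) +
      g.toFun x (J α x (coordField c b x)) (cov (coordField c e) x (coordField c a x)) := by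
    intro a b e
    rw [fderiv_coordForm_apply hc hJ.isOpen (hJ.smooth α) hw hwU,
      hLC.metric x _ _ _ (hJA b) (hA e), hSY a _ (hA b), map_sub, sub_apply,
      hK.adapted.swap (hJ.mem hwU α) (cov (coordField c b) x (coordField c a x))]
    ring
  refine ⟨S, hS, fun a b e ↦ ?_⟩
  -- After symmetrising by torsion-freeness, the terms with covariant derivatives of coordinate
  -- fields cancel in the cyclic sum.
  rw [extDerivBilin, hD, hD, hD, hsymm b a, hsymm e a, hsymm e b]
  ring

end Kahler

/-! ### The pulled-back form on the submanifold -/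

section Submanifold

open Module

variable {d : ℕ} {M : Type*} [TopologicalSpace M] [ChartedSpace (EuclideanSpace ℝ (Fin d)) M]
  [IsManifold (𝓡 d) ∞ M]
  {n : ℕ} {N : Type*} [TopologicalSpace N] [ChartedSpace (EuclideanSpace ℝ (Fin n)) N]
  [IsManifold (𝓡 n) ∞ N]
  {σ : AlmostParaquaternionicStructure d M} {g : SemiRiemannianMetric d M}
  {ι : N → M} {r : ℕ} {D : ∀ x : N, Submodule ℝ (TangentSpace (𝓡 n) x)}
  {U : Set M} {J : Fin 3 → EndField d M}

/-- For the converse, each `w` in `D` is `J u` with `u` in `D`, and skewness turns `g (v, J u)` into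
`-g (J v, u)`, which vanishes when `J v` is normal. -/
lemma mem_orthDistribution_iff (hg : IsAdapted σ g)
    (hN : IsParaquaternionicCRSubmanifold σ g ι r D) (hJ : IsCanonicalLocalBasis σ.toFun U J)
    {x : N} (hx : ι x ∈ U) (α : Fin 3) (v : TangentSpace (𝓡 n) x) :
    v ∈ orthDistribution g ι D x ↔
      IsNormalAt n g ι x (J α (ι x) (mfderiv (𝓡 n) (𝓡 d) ι x v)) := by
  refine ⟨fun hv ↦ hN.totallyReal U J hJ x hx α v hv, fun hv w hw ↦ ?_⟩
  have h : mfderiv (𝓡 n) (𝓡 d) ι x w ∈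
      J α (ι x) '' (mfderiv (𝓡 n) (𝓡 d) ι x '' (D x)) := by
    rw [hN.paraquaternionic U J hJ x hx α]
    exact mem_image_of_mem _ hw
  obtain ⟨_, ⟨u, hu, rfl⟩, hw'⟩ := h
  have h1 := hv u
  rw [hg.skew_basis hJ hx, neg_eq_zero] at h1
  rw [inducedMetric, ← hw']
  exact h1

/-- Normality is a linear condition, so it passes from a canonical basis to its span; this is what
handles the covariant derivatives of `J`. -/
lemma isNormalAt_of_mem (hN : IsParaquaternionicCRSubmanifold σ g ι r D) {x : N}
    {B : TangentSpace (𝓡 d) (ι x) →L[ℝ] TangentSpace (𝓡 d) (ι x)} (hB : B ∈ σ.toFun (ι x))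
    {v : TangentSpace (𝓡 n) x} (hv : v ∈ orthDistribution g ι D x) :
    IsNormalAt n g ι x (B (mfderiv (𝓡 n) (𝓡 d) ι x v)) := by
  obtain ⟨U, J, hx, hJ⟩ := σ.exists_basis (ι x)
  intro w
  rw [← hJ.span_eq _ hx] at hB
  induction hB using Submodule.span_induction with
  | mem B h =>
    obtain ⟨α, rfl⟩ := h
    exact hN.totallyReal U J hJ x hx α v hv w
  | zero => simp
  | add B C _ _ hB hC => simp only [add_apply, map_add, hB, hC, add_zero]
  | smul a B _ hB => simp only [smul_apply, map_smul, hB, smul_zero]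

/-- The induced metric at `x`, as a bilinear form. -/
def inducedBilin (g : SemiRiemannianMetric d M) (ι : N → M) (x : N) :
    LinearMap.BilinForm ℝ (TangentSpace (𝓡 n) x) :=
  LinearMap.mk₂ ℝ (inducedMetric g ι x) (by simp [inducedMetric]) (by simp [inducedMetric])
    (by simp [inducedMetric]) (by simp [inducedMetric])

lemma inducedMetric_symm (g : SemiRiemannianMetric d M) (ι : N → M) (x : N)
    (v w : TangentSpace (𝓡 n) x) : inducedMetric g ι x v w = inducedMetric g ι x w v :=
  g.symm _ _ _

instance finiteDimensional_tangentSpace (x : N) :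
    FiniteDimensional ℝ (TangentSpace (𝓡 n) x) :=
  inferInstanceAs (FiniteDimensional ℝ (EuclideanSpace ℝ (Fin n)))

lemma finrank_tangentSpace (x : N) : finrank ℝ (TangentSpace (𝓡 n) x) = n :=
  finrank_euclideanSpace_fin (𝕜 := ℝ) (n := n)

lemma IsDistribution.finrank_eq (hD : IsDistribution r D) (x : N) : finrank ℝ (D x) = r := by
  obtain ⟨V, X, _, hx, _, h⟩ := hD x
  rw [← (h x hx).2, finrank_span_eq_card (h x hx).1, Fintype.card_fin]

lemma finrank_orthDistribution (hN : IsParaquaternionicCRSubmanifold σ g ι r D) (x : N) :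
    finrank ℝ (orthDistribution g ι D x) = n - r := by
  have hsymm : (inducedBilin (n := n) g ι x).IsSymm :=
    ⟨fun v w ↦ inducedMetric_symm (n := n) g ι x v w⟩
  have hnd : (inducedBilin (n := n) g ι x).Nondegenerate := by
    refine (LinearMap.BilinForm.IsSymm.isRefl hsymm).nondegenerate_iff_separatingLeft.2 ?_
    exact fun v hv ↦ hN.nondegenerate x v trivial fun w _ ↦ hv w
  have h : orthDistribution g ι D x = (inducedBilin (n := n) g ι x).orthogonal (D x) := by
    ext v
    refine ⟨fun hv w hw ↦ ?_, fun hv w hw ↦ ?_⟩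
    · exact (inducedMetric_symm (n := n) g ι x w v).trans (hv w hw)
    · exact (inducedMetric_symm (n := n) g ι x v w).trans (hv w hw)
  rw [h, LinearMap.BilinForm.finrank_orthogonal hnd, finrank_tangentSpace,
    hN.isDistribution.finrank_eq]

/-- The derivative of `ι`, as a map between the model spaces. -/
def modelDeriv (n d : ℕ) {M : Type*} [TopologicalSpace M]
    [ChartedSpace (EuclideanSpace ℝ (Fin d)) M] {N : Type*} [TopologicalSpace N]
    [ChartedSpace (EuclideanSpace ℝ (Fin n)) N] (ι : N → M) (x : N) :
    EuclideanSpace ℝ (Fin n) →L[ℝ] EuclideanSpace ℝ (Fin d) := mfderiv (𝓡 n) (𝓡 d) ι x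

/-- The fibre of the structure bundle at `x`, in the endomorphisms of the model space. -/
def AlmostParaquaternionicStructure.fiberAt (σ : AlmostParaquaternionicStructure d M) (x : M) :
    Submodule ℝ (EuclideanSpace ℝ (Fin d) →L[ℝ] EuclideanSpace ℝ (Fin d)) := σ.toFun x

/-- The fibre of a distribution, as a subspace of the model space. -/
def modelFiber (D : ∀ x : N, Submodule ℝ (TangentSpace (𝓡 n) x)) (x : N) :
    Submodule ℝ (EuclideanSpace ℝ (Fin n)) := D x

/-- The domain of the coordinate expression of a form pulled back by `ι`. -/
def coordDomain (ι : N → M) (c : OpenPartialHomeomorph N (EuclideanSpace ℝ (Fin n)))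
    (c' : OpenPartialHomeomorph M (EuclideanSpace ℝ (Fin d))) (U : Set M) :
    Set (EuclideanSpace ℝ (Fin n)) :=
  c.target ∩ c.symm ⁻¹' (ι ⁻¹' (c'.source ∩ U))

/-- The coordinate expression of the map `ι`. -/
def coordMap (ι : N → M) (c : OpenPartialHomeomorph N (EuclideanSpace ℝ (Fin n)))
    (c' : OpenPartialHomeomorph M (EuclideanSpace ℝ (Fin d))) :
    EuclideanSpace ℝ (Fin n) → EuclideanSpace ℝ (Fin d) := fun z ↦ c' (ι (c.symm z))

/-- The coordinate expression of the pullback by `ι` of the two-form `g (J ·, ·)`. -/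
def inducedForm (g : SemiRiemannianMetric d M) (J : EndField d M) (ι : N → M)
    (c : OpenPartialHomeomorph N (EuclideanSpace ℝ (Fin n)))
    (c' : OpenPartialHomeomorph M (EuclideanSpace ℝ (Fin d))) (z : EuclideanSpace ℝ (Fin n)) :
    EuclideanSpace ℝ (Fin n) →L[ℝ] EuclideanSpace ℝ (Fin n) →L[ℝ] ℝ :=
  (coordForm g J c' (coordMap ι c c' z)).bilinearComp (fderiv ℝ (coordMap ι c c') z)
    (fderiv ℝ (coordMap ι c c') z)

variable {c : OpenPartialHomeomorph N (EuclideanSpace ℝ (Fin n))}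
  {c' : OpenPartialHomeomorph M (EuclideanSpace ℝ (Fin d))}

lemma isOpen_coordDomain (hι : Continuous ι) (hU : IsOpen U) :
    IsOpen (coordDomain ι c c' U) :=
  c.symm.isOpen_inter_preimage ((c'.open_source.inter hU).preimage hι)

lemma contDiffAt_coordMap (hι : ContMDiff (𝓡 n) (𝓡 d) ∞ ι)
    (hc : c ∈ IsManifold.maximalAtlas (𝓡 n) ∞ N) (hc' : c' ∈ IsManifold.maximalAtlas (𝓡 d) ∞ M)
    {z : EuclideanSpace ℝ (Fin n)} (hz : z ∈ coordDomain ι c c' U) :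
    ContDiffAt ℝ ∞ (coordMap ι c c') z := by
  have h1 := (contMDiffAt_of_mem_maximalAtlas hc' hz.2.1).comp z
    ((hι (c.symm z)).comp z (contMDiffAt_symm_of_mem_maximalAtlas hc hz.1))
  exact contMDiffAt_iff_contDiffAt.1 h1

/-- Chain rule for the two sides of `c'.symm ∘ coordMap ι c c' = ι ∘ c.symm`, valid near `z`. -/
lemma chartSymmDeriv_fderiv_coordMap (hι : ContMDiff (𝓡 n) (𝓡 d) ∞ ι)
    (hc : c ∈ IsManifold.maximalAtlas (𝓡 n) ∞ N) (hc' : c' ∈ IsManifold.maximalAtlas (𝓡 d) ∞ M)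
    (hU : IsOpen U) {z : EuclideanSpace ℝ (Fin n)} (hz : z ∈ coordDomain ι c c' U)
    (a : EuclideanSpace ℝ (Fin n)) :
    chartSymmDeriv c' (coordMap ι c c' z) (fderiv ℝ (coordMap ι c c') z a) =
      modelDeriv n d ι (c.symm z) (chartSymmDeriv c z a) := by
  have h1 := (contMDiffAt_symm_of_mem_maximalAtlas hc hz.1).mdifferentiableAt
    (by simp : (∞ : WithTop ℕ∞) ≠ 0)
  have h2 := (hι (c.symm z)).mdifferentiableAt (by simp : (∞ : WithTop ℕ∞) ≠ 0)
  have h3 : MDifferentiableAt (𝓡 n) (𝓡 d) (coordMap ι c c') z :=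
    ((contDiffAt_coordMap hι hc hc' hz).differentiableAt (by simp)).mdifferentiableAt
  have h4 := (contMDiffAt_symm_of_mem_maximalAtlas hc' (c'.map_source hz.2.1)).mdifferentiableAt
    (by simp : (∞ : WithTop ℕ∞) ≠ 0)
  have h5 : c'.symm ∘ coordMap ι c c' =ᶠ[𝓝 z] ι ∘ c.symm :=
    Filter.eventuallyEq_of_mem
      ((isOpen_coordDomain (c := c) (c' := c') hι.continuous hU).mem_nhds hz)
      fun y hy ↦ c'.left_inv hy.2.1
  have h6 := congrArg (fun T : EuclideanSpace ℝ (Fin n) →L[ℝ] EuclideanSpace ℝ (Fin d) ↦ T a)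
    (mfderiv_comp z h4 h3)
  have h7 := congrArg (fun T : EuclideanSpace ℝ (Fin n) →L[ℝ] EuclideanSpace ℝ (Fin d) ↦ T a)
    (mfderiv_comp z h2 h1)
  have h8 := congrArg (fun T : EuclideanSpace ℝ (Fin n) →L[ℝ] EuclideanSpace ℝ (Fin d) ↦ T a)
    (h5.mfderiv_eq (I := 𝓡 n) (I' := 𝓡 d))
  rw [mfderiv_eq_fderiv] at h6
  exact h6.symm.trans (h8.trans h7)

lemma inducedForm_apply (hι : ContMDiff (𝓡 n) (𝓡 d) ∞ ι)
    (hc : c ∈ IsManifold.maximalAtlas (𝓡 n) ∞ N) (hc' : c' ∈ IsManifold.maximalAtlas (𝓡 d) ∞ M)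
    (hU : IsOpen U) {J : EndField d M} {z : EuclideanSpace ℝ (Fin n)}
    (hz : z ∈ coordDomain ι c c' U) (a b : EuclideanSpace ℝ (Fin n)) :
    inducedForm g J ι c c' z a b = g.formAt (ι (c.symm z)) (J.endAt (ι (c.symm z))
      (modelDeriv n d ι (c.symm z) (chartSymmDeriv c z a)))
      (modelDeriv n d ι (c.symm z) (chartSymmDeriv c z b)) := by
  have h : c'.symm (coordMap ι c c' z) = ι (c.symm z) := c'.left_inv hz.2.1
  rw [← chartSymmDeriv_fderiv_coordMap hι hc hc' hU hz,
    ← chartSymmDeriv_fderiv_coordMap hι hc hc' hU hz, ← h]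
  rfl

lemma exists_equiv_chartSymmDeriv (hc : c ∈ IsManifold.maximalAtlas (𝓡 n) ∞ N)
    {z : EuclideanSpace ℝ (Fin n)} (hz : z ∈ c.target) :
    ∃ T : EuclideanSpace ℝ (Fin n) ≃L[ℝ] EuclideanSpace ℝ (Fin n),
      ∀ a, chartSymmDeriv c z a = T a := by
  obtain ⟨T, hT⟩ := isInvertible_mfderiv_chart_symm hc hz
  exact ⟨T, fun a ↦ (congrArg (fun S ↦ S a) hT).symm⟩

lemma inducedForm_eq_zero_iff (hg : IsAdapted σ g)
    (hN : IsParaquaternionicCRSubmanifold σ g ι r D) (hJ : IsCanonicalLocalBasis σ.toFun U J)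
    (α : Fin 3) (hc : c ∈ IsManifold.maximalAtlas (𝓡 n) ∞ N)
    (hc' : c' ∈ IsManifold.maximalAtlas (𝓡 d) ∞ M) {z : EuclideanSpace ℝ (Fin n)}
    (hz : z ∈ coordDomain ι c c' U) (a : EuclideanSpace ℝ (Fin n)) :
    inducedForm g (J α) ι c c' z a = 0 ↔
      chartSymmDeriv c z a ∈ modelFiber (orthDistribution g ι D) (c.symm z) := by
  refine Iff.trans ?_ (mem_orthDistribution_iff hg hN hJ hz.2.2 α (chartSymmDeriv c z a)).symm
  have happ := inducedForm_apply (g := g) (J := J α) hN.isImmersion.contMDiff hc hc' hJ.isOpen hz a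
  refine ⟨fun h v ↦ ?_, fun h ↦ ContinuousLinearMap.ext fun b ↦ ?_⟩
  · obtain ⟨T, hT⟩ := exists_equiv_chartSymmDeriv hc hz.1
    have hb : chartSymmDeriv c z (T.symm v) = v :=
      (hT (T.symm v)).trans (T.apply_symm_apply v)
    have h1 := (happ (T.symm v)).symm
    rw [h, hb] at h1
    exact h1
  · exact (happ b).trans (h _)

lemma contDiffOn_inducedForm (hι : ContMDiff (𝓡 n) (𝓡 d) ∞ ι)
    (hc : c ∈ IsManifold.maximalAtlas (𝓡 n) ∞ N) (hc' : c' ∈ IsManifold.maximalAtlas (𝓡 d) ∞ M)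
    (hU : IsOpen U) {J : EndField d M} (hJ : SmoothEndOn J U) :
    ContDiffOn ℝ ∞ (inducedForm g J ι c c') (coordDomain ι c c' U) := by
  refine contDiffOn_clm_apply.2 fun a ↦ contDiffOn_clm_apply.2 fun b ↦ fun z hz ↦ ?_
  have h1 := contDiffAt_coordMap hι hc hc' hz
  have h2 : ContDiffAt ℝ ∞ (fderiv ℝ (coordMap ι c c')) z := h1.fderiv_right (by simp)
  have h3 : ContDiffAt ℝ ∞ (coordForm g J c') (coordMap ι c c' z) := by
    refine (contDiffOn_coordForm hc' hU hJ).contDiffAt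
      ((isOpen_target_inter_preimage c' hU).mem_nhds ⟨c'.map_source hz.2.1, ?_⟩)
    show c'.symm (c' _) ∈ U
    rw [c'.left_inv hz.2.1]
    exact hz.2.2
  have h4 : ContDiffAt ℝ ∞ (fun z ↦ coordForm g J c' (coordMap ι c c' z)
      (fderiv ℝ (coordMap ι c c') z a) (fderiv ℝ (coordMap ι c c') z b)) z :=
    ((h3.comp z h1).clm_apply (h2.clm_apply contDiffAt_const)).clm_apply
      (h2.clm_apply contDiffAt_const)
  exact h4.contDiffWithinAt

lemma inducedForm_swap (hg : IsAdapted σ g) (hJ : IsCanonicalLocalBasis σ.toFun U J) (α : Fin 3)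
    (hc' : c' ∈ IsManifold.maximalAtlas (𝓡 d) ∞ M) {z : EuclideanSpace ℝ (Fin n)}
    (hz : z ∈ coordDomain ι c c' U) (a b : EuclideanSpace ℝ (Fin n)) :
    inducedForm g (J α) ι c c' z a b = -inducedForm g (J α) ι c c' z b a := by
  refine coordForm_swap hg hJ α hc' (c'.map_source hz.2.1) ?_ _ _
  show c'.symm (c' _) ∈ U
  rw [c'.left_inv hz.2.1]
  exact hz.2.2

/-- Each cyclic term has an element of `σ` acting on one vector. When that vector is `a` or `b` the
image is normal; when it is `e`, skewness first moves the action to `a`. -/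
lemma extDerivBilin_inducedForm (hK : IsParaquaternionicKahler σ g)
    (hN : IsParaquaternionicCRSubmanifold σ g ι r D) (hJ : IsCanonicalLocalBasis σ.toFun U J)
    (α : Fin 3) (hc : c ∈ IsManifold.maximalAtlas (𝓡 n) ∞ N)
    (hc' : c' ∈ IsManifold.maximalAtlas (𝓡 d) ∞ M) {z : EuclideanSpace ℝ (Fin n)}
    (hz : z ∈ coordDomain ι c c' U) {a b : EuclideanSpace ℝ (Fin n)}
    (ha : inducedForm g (J α) ι c c' z a = 0) (hb : inducedForm g (J α) ι c c' z b = 0)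
    (e : EuclideanSpace ℝ (Fin n)) :
    extDerivBilin (inducedForm g (J α) ι c c') z a b e = 0 := by
  have hι : ContMDiff (𝓡 n) (𝓡 d) ∞ ι := hN.isImmersion.contMDiff
  have hy : c'.symm (coordMap ι c c' z) = ι (c.symm z) := c'.left_inv hz.2.1
  have hyt : coordMap ι c c' z ∈ c'.target := c'.map_source hz.2.1
  have hyU : c'.symm (coordMap ι c c' z) ∈ U := hy ▸ hz.2.2
  have h1 := contDiffAt_coordMap hι hc hc' hz
  have h2 : ContDiffAt ℝ ∞ (fderiv ℝ (coordMap ι c c')) z := h1.fderiv_right (by simp)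
  have h3 : ContDiffAt ℝ ∞ (coordForm g (J α) c') (coordMap ι c c' z) :=
    (contDiffOn_coordForm hc' hJ.isOpen (hJ.smooth α)).contDiffAt
      ((isOpen_target_inter_preimage c' hJ.isOpen).mem_nhds ⟨hyt, hyU⟩)
  have hev : ∀ᶠ y in 𝓝 z, HasFDerivAt (coordMap ι c c') (fderiv ℝ (coordMap ι c c') y) y := by
    filter_upwards [(isOpen_coordDomain (c := c) (c' := c') hι.continuous hJ.isOpen).mem_nhds hz]
      with y hy
    exact ((contDiffAt_coordMap hι hc hc' hy).differentiableAt (by simp)).hasFDerivAt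
  have key := extDerivBilin_pullback hev (h2.differentiableAt (by simp))
    (h3.differentiableAt (by simp)) (coordForm_swap hK.adapted hJ α hc' hyt hyU) a b e
  obtain ⟨S, hS, hSd⟩ := exists_extDerivBilin_coordForm hK hJ α hc' hyt hyU
  have hS' : ∀ a, S a ∈ σ.fiberAt (ι (c.symm z)) := fun a ↦ hy ▸ hS a
  have hzero : ∀ B ∈ σ.fiberAt (ι (c.symm z)), ∀ a,
      inducedForm g (J α) ι c c' z a = 0 → ∀ e : EuclideanSpace ℝ (Fin n),
      g.formAt (ι (c.symm z)) (B (modelDeriv n d ι (c.symm z) (chartSymmDeriv c z a)))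
        (modelDeriv n d ι (c.symm z) (chartSymmDeriv c z e)) = 0 := fun B hB a ha e ↦
    isNormalAt_of_mem hN hB
      ((inducedForm_eq_zero_iff hK.adapted hN hJ α hc hc' hz a).1 ha) _
  have hform : ∀ B : EuclideanSpace ℝ (Fin d) →L[ℝ] EuclideanSpace ℝ (Fin d),
      ∀ a e : EuclideanSpace ℝ (Fin n),
      g.formAt (c'.symm (coordMap ι c c' z))
        (B (chartSymmDeriv c' (coordMap ι c c' z) (fderiv ℝ (coordMap ι c c') z a)))
        (chartSymmDeriv c' (coordMap ι c c' z) (fderiv ℝ (coordMap ι c c') z e)) =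
      g.formAt (ι (c.symm z)) (B (modelDeriv n d ι (c.symm z) (chartSymmDeriv c z a)))
        (modelDeriv n d ι (c.symm z) (chartSymmDeriv c z e)) := fun B a e ↦ by
    rw [chartSymmDeriv_fderiv_coordMap hι hc hc' hJ.isOpen hz,
      chartSymmDeriv_fderiv_coordMap hι hc hc' hJ.isOpen hz, hy]
  have hswap : ∀ B ∈ σ.fiberAt (ι (c.symm z)), ∀ v w : EuclideanSpace ℝ (Fin d),
      g.formAt (ι (c.symm z)) (B v) w = -g.formAt (ι (c.symm z)) (B w) v :=
    fun B hB v w ↦ hK.adapted.swap hB v w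
  refine key.trans ((hSd _ _ _).trans ?_)
  rw [coordField_symm hc' hyt, coordField_symm hc' hyt, coordField_symm hc' hyt]
  have t1 := (hform (S (fderiv ℝ (coordMap ι c c') z a)) b e).trans (hzero _ (hS' _) b hb e)
  have t2 := (hform (S (fderiv ℝ (coordMap ι c c') z b)) e a).trans
    ((hswap _ (hS' _) _ _).trans (neg_eq_zero.2 (hzero _ (hS' _) a ha e)))
  have t3 := (hform (S (fderiv ℝ (coordMap ι c c') z e)) a b).trans (hzero _ (hS' _) a ha b)
  have t := congrArg₂ (· + ·) (congrArg₂ (· + ·) t1 t2) t3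
  simp only [add_zero] at t
  exact t

lemma finrank_ker_inducedForm (hg : IsAdapted σ g)
    (hN : IsParaquaternionicCRSubmanifold σ g ι r D) (hJ : IsCanonicalLocalBasis σ.toFun U J)
    (α : Fin 3) (hc : c ∈ IsManifold.maximalAtlas (𝓡 n) ∞ N)
    (hc' : c' ∈ IsManifold.maximalAtlas (𝓡 d) ∞ M) {z : EuclideanSpace ℝ (Fin n)}
    (hz : z ∈ coordDomain ι c c' U) :
    finrank ℝ (LinearMap.ker (inducedForm g (J α) ι c c' z).toLinearMap) = n - r := by
  obtain ⟨T, hT⟩ := exists_equiv_chartSymmDeriv hc hz.1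
  have h : (LinearMap.ker (inducedForm g (J α) ι c c' z).toLinearMap).map
      (T.toLinearEquiv : EuclideanSpace ℝ (Fin n) →ₗ[ℝ] EuclideanSpace ℝ (Fin n)) =
      modelFiber (orthDistribution g ι D) (c.symm z) := by
    ext v
    refine ⟨?_, fun hv ↦ ⟨T.symm v, ?_, T.apply_symm_apply v⟩⟩
    · rintro ⟨a, ha, rfl⟩
      have := (inducedForm_eq_zero_iff hg hN hJ α hc hc' hz a).1 ha
      rw [hT] at this
      exact this
    · refine (inducedForm_eq_zero_iff hg hN hJ α hc hc' hz _).2 ?_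
      rw [hT]
      exact (T.apply_symm_apply v).symm ▸ hv
  exact (LinearEquiv.finrank_map_eq (T.toLinearEquiv :
    EuclideanSpace ℝ (Fin n) ≃ₗ[ℝ] EuclideanSpace ℝ (Fin n)) _).symm.trans
    ((congrArg (fun S : Submodule ℝ (EuclideanSpace ℝ (Fin n)) ↦ finrank ℝ S) h).trans
      (finrank_orthDistribution hN (c.symm z)))

end Submanifold

/-! ### Involutivity and flat charts -/

section Integrability

open Module

variable {d : ℕ} {M : Type*} [TopologicalSpace M] [ChartedSpace (EuclideanSpace ℝ (Fin d)) M]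
  [IsManifold (𝓡 d) ∞ M]
  {n : ℕ} {N : Type*} [TopologicalSpace N] [ChartedSpace (EuclideanSpace ℝ (Fin n)) N]
  [IsManifold (𝓡 n) ∞ N]
  {σ : AlmostParaquaternionicStructure d M} {g : SemiRiemannianMetric d M}
  {ι : N → M} {r : ℕ} {D : ∀ x : N, Submodule ℝ (TangentSpace (𝓡 n) x)}

/-- The coordinate expression of a vector field. -/
def coordExpr (c : OpenPartialHomeomorph N (EuclideanSpace ℝ (Fin n)))
    (X : ∀ x : N, TangentSpace (𝓡 n) x) : EuclideanSpace ℝ (Fin n) → EuclideanSpace ℝ (Fin n) :=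
  VectorField.mpullback (𝓡 n) (𝓡 n) c.symm X

lemma chartSymmDeriv_coordExpr {c : OpenPartialHomeomorph N (EuclideanSpace ℝ (Fin n))}
    (hc : c ∈ IsManifold.maximalAtlas (𝓡 n) ∞ N) {z : EuclideanSpace ℝ (Fin n)}
    (hz : z ∈ c.target) (X : ∀ x : N, TangentSpace (𝓡 n) x) :
    chartSymmDeriv c z (coordExpr c X z) = X (c.symm z) :=
  (isInvertible_mfderiv_chart_symm hc hz).inverse_apply_eq.1 rfl |>.symm

lemma differentiableAt_coordExpr {c : OpenPartialHomeomorph N (EuclideanSpace ℝ (Fin n))}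
    (hc : c ∈ IsManifold.maximalAtlas (𝓡 n) ∞ N) {z : EuclideanSpace ℝ (Fin n)}
    (hz : z ∈ c.target) {X : ∀ x : N, TangentSpace (𝓡 n) x} {W : Set N} (hW : IsOpen W)
    (hzW : c.symm z ∈ W) (hX : VFSmoothOn X W) : DifferentiableAt ℝ (coordExpr c X) z := by
  have h := ContMDiffAt.mpullback_vectorField_preimage (n := ∞)
    (hX.contMDiffAt (hW.mem_nhds hzW)) (contMDiffAt_symm_of_mem_maximalAtlas hc hz)
    (isInvertible_mfderiv_chart_symm hc hz) (by simp)
  exact (contMDiffAt_vectorSpace_iff_contDiffAt.1 h).differentiableAt (by simp)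

lemma coordExpr_mlieBracket {c : OpenPartialHomeomorph N (EuclideanSpace ℝ (Fin n))}
    (hc : c ∈ IsManifold.maximalAtlas (𝓡 n) ∞ N) {z : EuclideanSpace ℝ (Fin n)}
    (hz : z ∈ c.target) {X Y : ∀ x : N, TangentSpace (𝓡 n) x} {W : Set N} (hW : IsOpen W)
    (hzW : c.symm z ∈ W) (hX : VFSmoothOn X W) (hY : VFSmoothOn Y W) :
    coordExpr c (VectorField.mlieBracket (𝓡 n) X Y) z =
      VectorField.lieBracket ℝ (coordExpr c X) (coordExpr c Y) z := by
  have h := VectorField.mpullback_mlieBracket (n := ∞)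
    ((hX.contMDiffAt (hW.mem_nhds hzW)).mdifferentiableAt (by simp))
    ((hY.contMDiffAt (hW.mem_nhds hzW)).mdifferentiableAt (by simp))
    (contMDiffAt_symm_of_mem_maximalAtlas hc hz) minSmoothness_two_le_infty
  rw [← VectorField.mlieBracketWithin_univ (V := VectorField.mpullback (𝓡 n) (𝓡 n) c.symm X),
    VectorField.mlieBracketWithin_eq_lieBracketWithin] at h
  exact h.trans (congrFun VectorField.lieBracketWithin_univ z)

lemma isInvolutive_orthDistribution (hK : IsParaquaternionicKahler σ g)
    (hN : IsParaquaternionicCRSubmanifold σ g ι r D) :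
    IsInvolutive (orthDistribution g ι D) := by
  intro W X Y hW hX hY hXD hYD x hx
  have hι : ContMDiff (𝓡 n) (𝓡 d) ∞ ι := hN.isImmersion.contMDiff
  obtain ⟨U, J, hxU, hJ⟩ := σ.exists_basis (ι x)
  have hc := IsManifold.chart_mem_maximalAtlas (I := 𝓡 n) (n := ∞) x
  have hc' := IsManifold.chart_mem_maximalAtlas (I := 𝓡 d) (n := ∞) (ι x)
  have hxc' := mem_chart_source (EuclideanSpace ℝ (Fin d)) (ι x)
  have hxc := mem_chart_source (EuclideanSpace ℝ (Fin n)) x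
  generalize chartAt (EuclideanSpace ℝ (Fin n)) x = c at hc hxc
  generalize chartAt (EuclideanSpace ℝ (Fin d)) (ι x) = c' at hc' hxc'
  obtain ⟨z, hz, rfl⟩ : ∃ z ∈ c.target, c.symm z = x := ⟨c x, c.map_source hxc, c.left_inv hxc⟩
  have hzV : z ∈ coordDomain ι c c' U := ⟨hz, hxc', hxU⟩
  have hVo := isOpen_coordDomain (c := c) (c' := c') hι.continuous hJ.isOpen
  have hWo : IsOpen (c.target ∩ c.symm ⁻¹' W) := c.symm.isOpen_inter_preimage hW
  -- The choice of index `0` is immaterial: all three fundamental forms pull back to forms with the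
  -- same kernel.
  have hker : ∀ Z : ∀ x : N, TangentSpace (𝓡 n) x, (∀ x ∈ W, Z x ∈ orthDistribution g ι D x) →
      ∀ᶠ y in 𝓝 z, inducedForm g (J 0) ι c c' y (coordExpr c Z y) = 0 := fun Z hZ ↦ by
    filter_upwards [hVo.mem_nhds hzV, hWo.mem_nhds ⟨hz, hx⟩] with y hy hyW
    rw [inducedForm_eq_zero_iff hK.adapted hN hJ 0 hc hc' hy, chartSymmDeriv_coordExpr hc hy.1]
    exact hZ _ hyW.2
  have key := apply_lieBracket_eq_zero
    (((contDiffOn_inducedForm (g := g) hι hc hc' hJ.isOpen (hJ.smooth 0)).contDiffAt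
      (hVo.mem_nhds hzV)).differentiableAt (by simp))
    (Filter.eventually_of_mem (hVo.mem_nhds hzV)
      fun y hy a b ↦ inducedForm_swap hK.adapted hJ 0 hc' hy a b)
    (differentiableAt_coordExpr hc hz hW hx hX) (differentiableAt_coordExpr hc hz hW hx hY)
    (hker X hXD) (hker Y hYD)
    (fun e ↦ extDerivBilin_inducedForm hK hN hJ 0 hc hc' hzV (hker X hXD).self_of_nhds
      (hker Y hYD).self_of_nhds e)
  rw [← coordExpr_mlieBracket hc hz hW hx hX hY,
    inducedForm_eq_zero_iff hK.adapted hN hJ 0 hc hc' hzV, chartSymmDeriv_coordExpr hc hz] at key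
  exact key

lemma finrank_modelLeaf {p : ℕ} (hp : p ≤ n) : finrank ℝ (modelLeaf n p) = p := by
  let T : modelLeaf n p ≃ₗ[ℝ] (Fin p → ℝ) :=
    { toFun := fun v i ↦ v.1 (Fin.castLE hp i)
      map_add' := fun v w ↦ rfl
      map_smul' := fun a v ↦ rfl
      invFun := fun u ↦ ⟨WithLp.toLp 2 fun j ↦ if h : j.val < p then u ⟨j, h⟩ else 0,
        fun i hi ↦ dif_neg hi.not_gt⟩
      left_inv := fun v ↦ by
        ext j
        by_cases h : j.val < p
        · simp [h]
        · simp [h, v.2 j (not_lt.1 h)]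
      right_inv := fun u ↦ by
        ext i
        simp }
  rw [T.finrank_eq, finrank_fin_fun]

lemma isIntegrable_orthDistribution (hK : IsParaquaternionicKahler σ g)
    (hN : IsParaquaternionicCRSubmanifold σ g ι r D) :
    IsIntegrable (n - r) (orthDistribution g ι D) := by
  intro x
  have hι : ContMDiff (𝓡 n) (𝓡 d) ∞ ι := hN.isImmersion.contMDiff
  obtain ⟨U, J, hxU, hJ⟩ := σ.exists_basis (ι x)
  have hc := IsManifold.chart_mem_maximalAtlas (I := 𝓡 n) (n := ∞) x
  have hc' := IsManifold.chart_mem_maximalAtlas (I := 𝓡 d) (n := ∞) (ι x)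
  have hxc' := mem_chart_source (EuclideanSpace ℝ (Fin d)) (ι x)
  have hxc := mem_chart_source (EuclideanSpace ℝ (Fin n)) x
  generalize chartAt (EuclideanSpace ℝ (Fin n)) x = c at hc hxc
  generalize chartAt (EuclideanSpace ℝ (Fin d)) (ι x) = c' at hc' hxc'
  obtain ⟨z, hz, rfl⟩ : ∃ z ∈ c.target, c.symm z = x := ⟨c x, c.map_source hxc, c.left_inv hxc⟩
  have hzV : z ∈ coordDomain ι c c' U := ⟨hz, hxc', hxU⟩
  have hVo := isOpen_coordDomain (c := c) (c' := c') hι.continuous hJ.isOpen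
  obtain ⟨e, hze, heV, he, he', hflat⟩ := exists_flat_coordinates_ker hVo hzV
    (contDiffOn_inducedForm (g := g) hι hc hc' hJ.isOpen (hJ.smooth 0))
    (fun y hy a b ↦ inducedForm_swap hK.adapted hJ 0 hc' hy a b) (modelLeaf n (n - r))
    (fun y hy ↦ (finrank_ker_inducedForm hK.adapted hN hJ 0 hc hc' hy).trans
      (finrank_modelLeaf (n.sub_le r)).symm)
    (fun y hy a b e ha hb ↦ extDerivBilin_inducedForm hK hN hJ 0 hc hc' hy ha hb e)
  refine ⟨c.trans e, ?_, ?_, ?_⟩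
  · refine OpenPartialHomeomorph.mem_maximalAtlas_of_contMDiffOn _ ?_ ?_
    · have h1 := he.contMDiffOn.comp
        ((contMDiffOn_of_mem_maximalAtlas hc).mono (inter_subset_left (t := c ⁻¹' e.source)))
        (fun y hy ↦ hy.2)
      exact h1
    · have h1 := (contMDiffOn_symm_of_mem_maximalAtlas hc).comp
        (he'.contMDiffOn.mono (inter_subset_left (t := e.symm ⁻¹' c.target))) (fun y hy ↦ hy.2)
      exact h1
  · refine ⟨c.map_target hz, ?_⟩
    show c (c.symm z) ∈ e.source
    rwa [c.right_inv hz]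
  · intro y hy v
    obtain ⟨hyc, hye⟩ := hy
    obtain ⟨w, hw, rfl⟩ : ∃ w ∈ c.target, c.symm w = y :=
      ⟨c y, c.map_source hyc, c.left_inv hyc⟩
    replace hye : c (c.symm w) ∈ e.source := hye
    have hwe : w ∈ e.source := by rwa [c.right_inv hw] at hye
    obtain ⟨T, hT⟩ := exists_equiv_chartSymmDeriv hc hw
    obtain ⟨a, rfl⟩ : ∃ a, T a = v := ⟨T.symm v, T.apply_symm_apply v⟩
    have h1 : mfderiv (𝓡 n) (𝓡 n) c (c.symm w) (T a) = a := by
      have := congrArg (fun S : EuclideanSpace ℝ (Fin n) →L[ℝ] EuclideanSpace ℝ (Fin n) ↦ S a)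
        ((mdifferentiable_of_mem_maximalAtlas hc).comp_symm_deriv hw)
      rw [← hT]
      exact this
    have h2 : mvfderiv (𝓡 n) (c.trans e) (c.symm w) (T a) = fderiv ℝ e w a := by
      have h3 : MDifferentiableAt (𝓡 n) (𝓡 n) e (c (c.symm w)) :=
        ((he.contDiffAt (e.open_source.mem_nhds hye)).differentiableAt
          (by simp)).mdifferentiableAt
      have h4 := congrArg
        (fun S : EuclideanSpace ℝ (Fin n) →L[ℝ] EuclideanSpace ℝ (Fin n) ↦ S (T a))
        (mfderiv_comp (c.symm w) h3
          ((mdifferentiable_of_mem_maximalAtlas hc).mdifferentiableAt hyc))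
      refine h4.trans ?_
      rw [mfderiv_eq_fderiv, c.right_inv hw]
      exact congrArg (fderiv ℝ e w) h1
    rw [h2, ← hflat w hwe, inducedForm_eq_zero_iff hK.adapted hN hJ 0 hc hc' (heV hwe), hT]
    exact Iff.rfl

end Integrability

/-! ### From flat charts to a unique foliation -/

section Foliations

variable {n : ℕ} {N : Type*} [TopologicalSpace N] [ChartedSpace (EuclideanSpace ℝ (Fin n)) N]
  [IsManifold (𝓡 n) ∞ N] {φ ψ : OpenPartialHomeomorph N (EuclideanSpace ℝ (Fin n))} {p : ℕ}
  {D : ∀ x : N, Submodule ℝ (TangentSpace (𝓡 n) x)}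

/-- The derivative of the chart `φ`. -/
def chartDeriv (φ : OpenPartialHomeomorph N (EuclideanSpace ℝ (Fin n))) (x : N) :
    EuclideanSpace ℝ (Fin n) →L[ℝ] EuclideanSpace ℝ (Fin n) := mvfderiv (𝓡 n) φ x

lemma contDiffOn_transition (hφ : φ ∈ IsManifold.maximalAtlas (𝓡 n) ∞ N)
    (hψ : ψ ∈ IsManifold.maximalAtlas (𝓡 n) ∞ N) :
    ContDiffOn ℝ ∞ (fun y ↦ ψ (φ.symm y)) (φ.symm.trans ψ).source := by
  have h := (contMDiffOn_of_mem_maximalAtlas hψ).comp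
    ((contMDiffOn_symm_of_mem_maximalAtlas hφ).mono (inter_subset_left (t := φ.symm ⁻¹' ψ.source)))
    (fun y hy ↦ hy.2)
  exact contMDiffOn_iff_contDiffOn.1 h

lemma differentiableAt_transition (hφ : φ ∈ IsManifold.maximalAtlas (𝓡 n) ∞ N)
    (hψ : ψ ∈ IsManifold.maximalAtlas (𝓡 n) ∞ N) {y : EuclideanSpace ℝ (Fin n)}
    (hy : y ∈ (φ.symm.trans ψ).source) : DifferentiableAt ℝ (fun y ↦ ψ (φ.symm y)) y :=
  ((contDiffOn_transition hφ hψ).contDiffAt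
    ((φ.symm.trans ψ).open_source.mem_nhds hy)).differentiableAt (by simp)

lemma map_mem_transition_source {x : N} (hxφ : x ∈ φ.source) (hxψ : x ∈ ψ.source) :
    φ x ∈ (φ.symm.trans ψ).source := by
  refine ⟨φ.map_source hxφ, ?_⟩
  show φ.symm (φ x) ∈ ψ.source
  rwa [φ.left_inv hxφ]

lemma fderiv_transition (hφ : φ ∈ IsManifold.maximalAtlas (𝓡 n) ∞ N)
    (hψ : ψ ∈ IsManifold.maximalAtlas (𝓡 n) ∞ N) {x : N} (hxφ : x ∈ φ.source)
    (hxψ : x ∈ ψ.source) (v : EuclideanSpace ℝ (Fin n)) :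
    fderiv ℝ (fun y ↦ ψ (φ.symm y)) (φ x) (chartDeriv φ x v) = chartDeriv ψ x v := by
  have h1 := (differentiableAt_transition hφ hψ
    (map_mem_transition_source hxφ hxψ)).mdifferentiableAt
  have h2 := (mdifferentiable_of_mem_maximalAtlas hφ).mdifferentiableAt hxφ
  have h3 : (fun y ↦ ψ (φ.symm y)) ∘ φ =ᶠ[𝓝 x] ψ :=
    Filter.eventuallyEq_of_mem (φ.open_source.mem_nhds hxφ)
      fun y hy ↦ congrArg ψ (φ.left_inv hy)
  have h4 := congrArg (fun T : EuclideanSpace ℝ (Fin n) →L[ℝ] EuclideanSpace ℝ (Fin n) ↦ T v)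
    (mfderiv_comp x h1 h2)
  have h5 := congrArg (fun T : EuclideanSpace ℝ (Fin n) →L[ℝ] EuclideanSpace ℝ (Fin n) ↦ T v)
    (h3.mfderiv_eq (I := 𝓡 n) (I' := 𝓡 n))
  rw [mfderiv_eq_fderiv] at h4
  exact h4.symm.trans h5

lemma exists_chartDeriv_eq (hφ : φ ∈ IsManifold.maximalAtlas (𝓡 n) ∞ N) {x : N}
    (hx : x ∈ φ.source) (a : EuclideanSpace ℝ (Fin n)) : ∃ v, chartDeriv φ x v = a := by
  obtain ⟨T, hT⟩ := isInvertible_mfderiv_chart hφ hx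
  exact ⟨T.symm a, (congrArg (fun S ↦ S (T.symm a)) hT).symm.trans (T.apply_symm_apply a)⟩

/-- The derivative of the transition map preserves the model leaf direction. On a ball, convexity
and the mean value theorem, applied to each transverse coordinate, integrate this to pairs of
points. -/
lemma PlaqueCompatible.of_isFlatOn (hφ : φ ∈ IsManifold.maximalAtlas (𝓡 n) ∞ N)
    (hψ : ψ ∈ IsManifold.maximalAtlas (𝓡 n) ∞ N) (hφD : IsFlatOn p D φ) (hψD : IsFlatOn p D ψ) :
    PlaqueCompatible p φ ψ := by
  intro z hz
  obtain ⟨ε, hε, hball⟩ := Metric.isOpen_iff.1 (φ.symm.trans ψ).open_source z hz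
  have hleaf : ∀ y ∈ (φ.symm.trans ψ).source, ∀ a ∈ modelLeaf n p,
      fderiv ℝ (fun y ↦ ψ (φ.symm y)) y a ∈ modelLeaf n p := by
    rintro y ⟨hy, hyψ⟩ a ha
    have hxφ : φ.symm y ∈ φ.source := φ.map_target hy
    obtain ⟨v, rfl⟩ := exists_chartDeriv_eq hφ hxφ a
    have h := fderiv_transition hφ hψ hxφ hyψ v
    rw [φ.right_inv hy] at h
    rw [h]
    exact (hψD _ hyψ v).1 ((hφD _ hxφ v).2 ha)
  refine ⟨Metric.ball z ε, Metric.isOpen_ball, Metric.mem_ball_self hε, hball,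
    fun a ha b hb hab i hi ↦ ?_⟩
  obtain ⟨y, hy, h⟩ := domain_mvt (f := fun y ↦ ψ (φ.symm y) i)
    (f' := fun y ↦ (EuclideanSpace.proj i).comp (fderiv ℝ (fun y ↦ ψ (φ.symm y)) y))
    (fun y hy ↦ ((EuclideanSpace.proj i : EuclideanSpace ℝ (Fin n) →L[ℝ] ℝ).hasFDerivAt.comp y
      (differentiableAt_transition hφ hψ (hball hy)).hasFDerivAt).hasFDerivWithinAt)
    (convex_ball z ε) hb ha
  exact h.trans (hleaf y (hball ((convex_ball z ε).segment_subset hb ha hy)) _ hab i hi)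

/-- Along the line `φ x + t • a` inside a plaque, the transverse coordinates of the transition map
are constant near `t = 0`, so their derivatives vanish. -/
lemma PlaqueCompatible.chartDeriv_mem (h : PlaqueCompatible p φ ψ)
    (hφ : φ ∈ IsManifold.maximalAtlas (𝓡 n) ∞ N) (hψ : ψ ∈ IsManifold.maximalAtlas (𝓡 n) ∞ N)
    {x : N} (hxφ : x ∈ φ.source) (hxψ : x ∈ ψ.source) {v : EuclideanSpace ℝ (Fin n)}
    (hv : chartDeriv φ x v ∈ modelLeaf n p) : chartDeriv ψ x v ∈ modelLeaf n p := by
  have hx := map_mem_transition_source hxφ hxψ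
  obtain ⟨W, hW, hxW, -, hWL⟩ := h (φ x) hx
  rw [← fderiv_transition hφ hψ hxφ hxψ]
  intro i hi
  set a := chartDeriv φ x v
  have hline : HasDerivAt (fun t : ℝ ↦ φ x + t • a) a 0 := by
    simpa using ((hasDerivAt_id (0 : ℝ)).smul_const a).const_add (φ x)
  have h0 : φ x + (0 : ℝ) • a = φ x := by simp
  have hτ : HasFDerivAt (fun y ↦ ψ (φ.symm y)) (fderiv ℝ (fun y ↦ ψ (φ.symm y)) (φ x))
      (φ x + (0 : ℝ) • a) := by
    rw [h0]
    exact (differentiableAt_transition hφ hψ hx).hasFDerivAt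
  have hτa := HasFDerivAt.comp_hasDerivAt (0 : ℝ) (f := fun t : ℝ ↦ φ x + t • a) hτ hline
  have hd : HasDerivAt (fun t : ℝ ↦ ψ (φ.symm (φ x + t • a)) i)
      (fderiv ℝ (fun y ↦ ψ (φ.symm y)) (φ x) a i) 0 :=
    (EuclideanSpace.proj i : EuclideanSpace ℝ (Fin n) →L[ℝ] ℝ).hasFDerivAt.comp_hasDerivAt
      (0 : ℝ) hτa
  have hconst : (fun t : ℝ ↦ ψ (φ.symm (φ x + t • a)) i) =ᶠ[𝓝 0]
      fun _ ↦ ψ (φ.symm (φ x)) i := by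
    filter_upwards [hline.continuousAt.preimage_mem_nhds (hW.mem_nhds (h0.symm ▸ hxW))] with t ht
    refine sub_eq_zero.1 (hWL _ ht _ hxW ?_ i hi)
    rw [add_sub_cancel_left]
    exact (modelLeaf n p).smul_mem t hv
  exact hd.unique ((hasDerivAt_const (0 : ℝ) _).congr_of_eventuallyEq hconst)

/-- The foliation defined by an integrable distribution: its charts are all the flat charts. -/
def IsIntegrable.foliation (hD : IsIntegrable p D) : Foliation n N p where
  atlas := {φ | φ ∈ IsManifold.maximalAtlas (𝓡 n) ∞ N ∧ IsFlatOn p D φ}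
  subset_maximalAtlas := fun _ h ↦ h.1
  covers := fun x ↦
    let ⟨φ, hφ, hx, hφD⟩ := hD x
    ⟨φ, ⟨hφ, hφD⟩, hx⟩
  compatible := fun _ hφ _ hψ ↦ .of_isFlatOn hφ.1 hψ.1 hφ.2 hψ.2
  maximal := fun φ hφ h ↦ ⟨hφ, fun x hx v ↦ by
    obtain ⟨ψ, hψ, hxψ, hψD⟩ := hD x
    obtain ⟨h1, h2⟩ := h ψ ⟨hψ, hψD⟩
    exact (hψD x hxψ v).trans
      ⟨fun hv ↦ h2.chartDeriv_mem hψ hφ hxψ hx hv, fun hv ↦ h1.chartDeriv_mem hφ hψ hx hxψ hv⟩⟩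

/-- A foliation tangent to `D` has only flat charts. Conversely, every flat chart is compatible with
all of its charts and so belongs to it by maximality. -/
theorem IsIntegrable.existsUnique_foliation (hD : IsIntegrable p D) :
    ∃! F : Foliation n N p, F.HasStructuralDistribution D := by
  refine ⟨hD.foliation, fun φ hφ ↦ hφ.2, fun F hF ↦ Foliation.ext (Subset.antisymm ?_ ?_)⟩
  · exact fun φ hφ ↦ ⟨F.subset_maximalAtlas hφ, hF φ hφ⟩
  · rintro φ ⟨hφ, hφD⟩
    refine F.maximal φ hφ fun ψ hψ ↦ ?_
    have hψ' := F.subset_maximalAtlas hψ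
    exact ⟨.of_isFlatOn hφ hψ' hφD (hF ψ hψ), .of_isFlatOn hψ' hφ (hF ψ hψ) hφD⟩

end Foliations

end ParaquaternionicCR

end

theorem mainTheorem1
    {d : ℕ} {M : Type*} [TopologicalSpace M] [T2Space M]
    [ChartedSpace (EuclideanSpace ℝ (Fin d)) M] [IsManifold (𝓡 d) ∞ M]
    (σ : ParaquaternionicCR.AlmostParaquaternionicStructure d M)
    (g : ParaquaternionicCR.SemiRiemannianMetric d M)
    (hM : ParaquaternionicCR.IsParaquaternionicKahler σ g)
    {n : ℕ} {N : Type*} [TopologicalSpace N] [T2Space N]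
    [ChartedSpace (EuclideanSpace ℝ (Fin n)) N] [IsManifold (𝓡 n) ∞ N]
    (ι : N → M) (r : ℕ) (D : ∀ x : N, Submodule ℝ (TangentSpace (𝓡 n) x))
    (hN : ParaquaternionicCR.IsParaquaternionicCRSubmanifold σ g ι r D) :
    ParaquaternionicCR.IsInvolutive (ParaquaternionicCR.orthDistribution g ι D) ∧
    ParaquaternionicCR.IsIntegrable (n - r) (ParaquaternionicCR.orthDistribution g ι D) ∧
    ∃! F : ParaquaternionicCR.Foliation n N (n - r),
      F.HasStructuralDistribution (ParaquaternionicCR.orthDistribution g ι D) :=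
  ⟨ParaquaternionicCR.isInvolutive_orthDistribution hM hN,
    ParaquaternionicCR.isIntegrable_orthDistribution hM hN,
    (ParaquaternionicCR.isIntegrable_orthDistribution hM hN).existsUnique_foliation⟩
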